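/- Let $n\ge 2$. On the Heisenberg group $H_n=\mathbb R^{2n}\times\mathbb R$ with coordinates $(x,y,t)$ let $\Theta=dt+\sum_{j=1}^n(x_j\,dy_j-y_j\,dx_j)$, $\xi=\ker\Theta$, $T=\partial_t$, $E_j=\partial_{x_j}+y_j\partial_t$, $E_{n+j}=\partial_{y_j}-x_j\partial_t$, let $J$ be the CR structure on $\xi$ with $JE_j=E_{n+j}$, $JE_{n+j}=-E_j$, let $G=\sum_j(dx_j^2+dy_j^2)$ be the Levi metric, and let $\nabla$ be the pseudohermitian connection, for which $E_1,\dots,E_{2n},T$ are parallel. A Heisenberg rigid motion is a diffeomorphism of $H_n$ preserving $\Theta$ and $J$. A point of a hypersurface $\Sigma\subset H_n$ is singular if $T\Sigma=\xi$ there, and regular otherwise. At regular points put $\xi'=(\xi\cap T\Sigma)\cap J(\xi\cap T\Sigma)$, let $e_n$ be a (locally defined, $C^1$) unit field in $\xi\cap T\Sigma$ orthogonal to $\xi'$, $e_{2n}=Je_n$, let $\alpha$ be the function with $\alpha e_{2n}+T\in T\Sigma$, and let $J'=J$ on $\xi'$, $J'e_n=0$. The shape operator on $\xi\cap T\Sigma$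 is $\mathfrak S(v)=-\nabla_v e_{2n}+\alpha J'v$, and the $p$-mean curvature is $H=\operatorname{tr}\mathfrak S$. The hypersurface is $p$-minimal if $H=0$ at all regular points, and umbilic if at every regular point $\mathfrak S(\xi')\subset\xi'$ and all eigenvalues of $\mathfrak S$ on $\xi'$ coincide. **Theorem.** Let $f:\mathbb R^{2n}\to\mathbb R$ be a $C^2$ function, and suppose that $f$ is $C^\infty$ near every $(x,y)$ over which the graph $\Sigma=\{t=f(x,y)\}$ is regular. If $\Sigma$ is $p$-minimal and umbilic, then there is a Heisenberg rigid motion $\Phi$ such that $\Phi(\Sigma)$ is a horizontal hyperplane $\{t=c\}$, $c\in\mathbb R$. -/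

import Mathlib

open scoped ContDiff Topology

noncomputable section

namespace Heisenberg

/-- The Heisenberg group `H_n` in its global coordinates: the point `(x, y, t)` is written `(z, t)`
with `z_j = x_j + i y_j`. Tangent vectors at a point are given by their components in the coordinate
frame `∂/∂x_j, ∂/∂y_j, ∂/∂t`, so every tangent space is again `ℂⁿ × ℝ`. -/
abbrev Heis (n : ℕ) : Type := EuclideanSpace ℂ (Fin n) × ℝ

variable {n : ℕ}

/-- The contact form `Θ = dt + ∑ (x_j dy_j - y_j dx_j)` at the point `p`. -/
def contactForm (p : Heis n) : Heis n →ₗ[ℝ] ℝ where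
  toFun v := v.2 + ∑ j, ((p.1 j).re * (v.1 j).im - (p.1 j).im * (v.1 j).re)
  map_add' v w := by
    simp only [Prod.snd_add, Prod.fst_add, PiLp.add_apply, Complex.add_re, Complex.add_im]
    have h : ∀ j, (p.1 j).re * ((v.1 j).im + (w.1 j).im) - (p.1 j).im * ((v.1 j).re + (w.1 j).re)
        = ((p.1 j).re * (v.1 j).im - (p.1 j).im * (v.1 j).re)
          + ((p.1 j).re * (w.1 j).im - (p.1 j).im * (w.1 j).re) := fun j => by ring
    simp only [h, Finset.sum_add_distrib]
    ring
  map_smul' c v := by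
    simp only [Prod.smul_snd, Prod.smul_fst, PiLp.smul_apply, Complex.smul_re, Complex.smul_im,
      smul_eq_mul, RingHom.id_apply, mul_add, Finset.mul_sum]
    congr 1
    exact Finset.sum_congr rfl fun j _ => by ring

/-- The contact bundle `ξ = ker Θ` at `p`. -/
def contactSpace (p : Heis n) : Submodule ℝ (Heis n) := LinearMap.ker (contactForm p)

/-- The Reeb field `T = ∂/∂t`. -/
def reeb : Heis n := (0, 1)

/-- The horizontal vector `∑ (a_j E_j + b_j E_{n+j})` at `p`, where `c_j = a_j + i b_j` and
`E_j = ∂/∂x_j + y_j ∂/∂t`, `E_{n+j} = ∂/∂y_j - x_j ∂/∂t` is the left-invariant frame of `ξ`. -/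
def horizontalVector (p : Heis n) (c : EuclideanSpace ℂ (Fin n)) : Heis n :=
  (c, ∑ j, ((c j).re * (p.1 j).im - (c j).im * (p.1 j).re))

/-- The standard CR structure `J E_j = E_{n+j}`, `J E_{n+j} = - E_j` on `ξ` at `p`, extended by
`J T = 0` to a linear map of the whole tangent space. -/
def J (p : Heis n) : Heis n →ₗ[ℝ] Heis n where
  toFun v := horizontalVector p (Complex.I • v.1)
  map_add' v w := by
    refine Prod.ext (by simp [horizontalVector]) ?_
    simp only [horizontalVector, Prod.fst_add, Prod.snd_add, smul_add, PiLp.add_apply,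
      Complex.add_re, Complex.add_im, ← Finset.sum_add_distrib]
    exact Finset.sum_congr rfl fun j _ => by ring
  map_smul' c v := by
    refine Prod.ext (smul_comm Complex.I c v.1) ?_
    simp only [horizontalVector, Prod.smul_fst, Prod.smul_snd, RingHom.id_apply, smul_eq_mul,
      Finset.mul_sum, PiLp.smul_apply, Complex.smul_re, Complex.smul_im, Complex.mul_re,
      Complex.mul_im, Complex.I_re, Complex.I_im]
    exact Finset.sum_congr rfl fun j _ => by ring

/-- The Levi metric `G = ½ dΘ(·, J·) = ∑ (dx_j² + dy_j²)` (it does not depend on the point). -/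
def levi (v w : Heis n) : ℝ :=
  ∑ j, ((v.1 j).re * (w.1 j).re + (v.1 j).im * (w.1 j).im)

/-- A Heisenberg rigid motion (an element of `PSH(n)`): a diffeomorphism of `H_n` which preserves
the contact form `Θ` and the CR structure `J` on `ξ`. -/
structure IsRigidMotion (Φ : Heis n ≃ Heis n) : Prop where
  contDiff : ContDiff ℝ ∞ Φ
  contDiff_symm : ContDiff ℝ ∞ Φ.symm
  pullback_contactForm : ∀ p v, contactForm (Φ p) (fderiv ℝ Φ p v) = contactForm p v
  comm_J : ∀ p, ∀ v ∈ contactSpace p, fderiv ℝ Φ p (J p v) = J (Φ p) (fderiv ℝ Φ p v)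

/-- A horizontal hyperplane `{t = c}`. -/
def IsHorizontalHyperplane (S : Set (Heis n)) : Prop := ∃ c : ℝ, S = {p | p.2 = c}

/-! ### Immersed hypersurfaces
A hypersurface is given by an immersion `X : M → H_n`, where `M` is a `2n`-dimensional real
vector space. -/

variable {M : Type*} [NormedAddCommGroup M] [NormedSpace ℝ M]

/-- The tangent space of the hypersurface at the point `X m`. -/
def tangentSpace (X : M → Heis n) (m : M) : Submodule ℝ (Heis n) :=
  LinearMap.range (fderiv ℝ X m : M →ₗ[ℝ] Heis n)

/-- The point `X m` is singular if `ξ = TΣ` there, and regular otherwise. -/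
def IsRegularPoint (X : M → Heis n) (m : M) : Prop :=
  contactSpace (X m) ≠ tangentSpace X m

/-- `ξ ∩ TΣ` at the point `X m`. -/
def horizontalTangent (X : M → Heis n) (m : M) : Submodule ℝ (Heis n) :=
  contactSpace (X m) ⊓ tangentSpace X m

/-- `ξ' = (ξ ∩ TΣ) ∩ J (ξ ∩ TΣ)` at the point `X m`. -/
def xiPrime (X : M → Heis n) (m : M) : Submodule ℝ (Heis n) :=
  horizontalTangent X m ⊓ (horizontalTangent X m).map (J (X m))

/-- The pseudohermitian (Tanaka-Webster) connection of `(J, Θ)` on `H_n`, for which the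
left-invariant frame `E_1, …, E_{2n}, T` is parallel: `covDeriv X V m w` is the covariant derivative
`∇_v V`, with `v = dX(w)`, of the vector field `V` along the hypersurface. The coefficients of `V`
with respect to the frame are the components of `V.1` and the number `Θ(V)`. -/
def covDeriv (X V : M → Heis n) (m w : M) : Heis n :=
  horizontalVector (X m) (fderiv ℝ (fun m' => (V m').1) m w)
    + fderiv ℝ (fun m' => contactForm (X m') (V m')) m w • reeb

/-- The field `e_{2n} = J e_n` along the hypersurface. -/
def horizontalNormal (X e : M → Heis n) (m : M) : Heis n := J (X m) (e m)

/-- Near `X m`, the vector field `e` along the hypersurface is a choice of the field `e_n`, that is,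
a unit vector field in `ξ ∩ TΣ` perpendicular to `ξ'` (such a field is unique up to sign), and `α`
is the value at `X m` of the function with `α e_{2n} + T ∈ TΣ`. -/
structure IsCharacteristicFrameAt (X : M → Heis n) (m : M) (e : M → Heis n) (α : ℝ) : Prop where
  contDiffAt : ContDiffAt ℝ 1 e m
  mem : ∀ᶠ m' in 𝓝 m, e m' ∈ horizontalTangent X m'
  perp : ∀ᶠ m' in 𝓝 m, ∀ v ∈ xiPrime X m', levi (e m') v = 0
  unit : ∀ᶠ m' in 𝓝 m, levi (e m') (e m') = 1
  alpha_mem : α • horizontalNormal X e m + reeb ∈ tangentSpace X m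

/-- `J'` on `ξ ∩ TΣ = ξ' ⊕ ℝ e_n`: equal to `J` on `ξ'`, and `J' e_n = 0`. -/
def JPrime (X e : M → Heis n) (m : M) (v : Heis n) : Heis n :=
  J (X m) (v - levi v (e m) • e m)

/-- The shape operator `𝔖(v) = -∇_v e_{2n} + α J' v` at `X m`, for `v = dX(w) ∈ ξ ∩ TΣ`. -/
def shapeOperator (X e : M → Heis n) (α : ℝ) (m w : M) : Heis n :=
  - covDeriv X (horizontalNormal X e) m w + α • JPrime X e m (fderiv ℝ X m w)

/-- `X m` is an umbilic point: `𝔖(ξ') ⊆ ξ'` and all the eigenvalues of `𝔖` on `ξ'` are the same.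
(Replacing `e_n` by `-e_n` turns `α` into `-α` and `𝔖` into `-𝔖`, so that the choice of `e_n` is
immaterial.) -/
def IsUmbilicAt (X : M → Heis n) (m : M) : Prop :=
  ∃ (e : M → Heis n) (α : ℝ), IsCharacteristicFrameAt X m e α ∧
    (∀ w, fderiv ℝ X m w ∈ xiPrime X m → shapeOperator X e α m w ∈ xiPrime X m) ∧
    ∃ k : ℝ, ∀ (μ : ℝ) (w : M), w ≠ 0 → fderiv ℝ X m w ∈ xiPrime X m →
      shapeOperator X e α m w = μ • fderiv ℝ X m w → μ = k

/-- The hypersurface is umbilic if all its regular points are umbilic. -/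
def IsUmbilic (X : M → Heis n) : Prop := ∀ m, IsRegularPoint X m → IsUmbilicAt X m

/-- With respect to some choice of `e_n` near `X m`, the `p`-mean curvature at `X m` is `h`. The
`p`-mean curvature is the trace of the shape operator on the `(2n-1)`-dimensional space `ξ ∩ TΣ`,
computed in a basis `dX(b_1), …, dX(b_{2n-1})` orthonormal for the Levi metric; it changes sign
with `e_n`. -/
def HasPMeanCurvatureAt (X : M → Heis n) (m : M) (h : ℝ) : Prop :=
  ∃ (e : M → Heis n) (α : ℝ), IsCharacteristicFrameAt X m e α ∧
    ∃ b : Fin (2 * n - 1) → M,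
      (∀ i, fderiv ℝ X m (b i) ∈ contactSpace (X m)) ∧
      (∀ i j, levi (fderiv ℝ X m (b i)) (fderiv ℝ X m (b j)) = if i = j then 1 else 0) ∧
      h = ∑ i, levi (shapeOperator X e α m (b i)) (fderiv ℝ X m (b i))

/-- The hypersurface is `p`-minimal: the `p`-mean curvature vanishes at all regular points. -/
def IsPMinimal (X : M → Heis n) : Prop := ∀ m, IsRegularPoint X m → HasPMeanCurvatureAt X m 0

/-- The graph `t = f(z)` over `ℂⁿ = ℝ²ⁿ`, as an immersion. -/
def graphMap (f : EuclideanSpace ℂ (Fin n) → ℝ) (z : EuclideanSpace ℂ (Fin n)) : Heis n := (z, f z)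

end Heisenberg

end

/-!
Along the graph `t = f(z)` the contact form restricts to `⟪U, dz⟫`, where `U = ∇f + i z`; the graph
is singular exactly at the zeros of `U`, and `DU = A + i` with `A` the Hessian of `f`. Up to a
nonzero factor, and modulo `U`, the shape operator is `A` restricted to the orthogonal complement of
`U` (`exists_shapeOperator_fst`). A `p`-minimal umbilic graph therefore has, where `U ≠ 0`,
`A = k + U ⊗ b + b ⊗ U + σ iU ⊗ iU` with `σ |U|² = -m k`, `m = 2n - 1`
(`isUmbilicMinimalField_graph`, `IsUmbilicMinimalField.apply_eq`).

The Codazzi equation, that is the symmetry of the third derivatives of `f`, then determines `b` and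
the derivative of `k` completely. With `ν = iU - kU` the result is
`A = k - (m k / |U|²) ν ⊗ ν` and `dk = (m k (1 + k²) / |U|²) ⟪ν, ·⟫`
(`IsUmbilicMinimalField.apply_eq_slope`, `IsUmbilicMinimalField.fderiv_scal`). Consequently the
point `z + ν / (1 + k²)` and the number `|U|²ᵐ k² / (1 + k²)ᵐ⁺¹` are locally constant where `U ≠ 0`
(`IsUmbilicMinimalField.hasFDerivAt_centre`, `IsUmbilicMinimalField.hasFDerivAt_energy`).

If `k ≠ 0` somewhere, the common level set of these two first integrals through such a point is
open, and it is closed because the second one bounds `|U|` from below on it. So it is all of `ℂⁿ`,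
and it contains the centre `z + ν / (1 + k²)`, at which `ν` and hence `U` would vanish: a
contradiction (`IsUmbilicMinimalField.scal_eq_zero`). Therefore `k = 0`, the Hessian
vanishes where `U ≠ 0`, and by density everywhere (`IsUmbilicMinimalField.dense_ne_zero`). Thus `f` is affine, and a left
translation moves its graph to a horizontal hyperplane (`exists_rigidMotion_of_affine`).
-/

open scoped InnerProductSpace

noncomputable section

namespace Heisenberg

/-! ### Hermitian structures -/

section umbilicField

variable {V : Type*} [NormedAddCommGroup V] [InnerProductSpace ℝ V]

/-- A linear complex structure compatible with the inner product. -/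
structure IsHermitianStructure (j : V →L[ℝ] V) : Prop where
  sq : ∀ v, j (j v) = -v
  skew : ∀ v w, ⟪j v, w⟫_ℝ = -⟪v, j w⟫_ℝ

namespace IsHermitianStructure

variable {j : V →L[ℝ] V}

lemma inner_self_left (hj : IsHermitianStructure j) (v : V) : ⟪j v, v⟫_ℝ = 0 := by
  have h := hj.skew v v
  rw [real_inner_comm (j v) v] at h
  linarith

lemma inner_self_right (hj : IsHermitianStructure j) (v : V) : ⟪v, j v⟫_ℝ = 0 := by
  rw [real_inner_comm, hj.inner_self_left]

lemma inner_map_map (hj : IsHermitianStructure j) (v w : V) : ⟪j v, j w⟫_ℝ = ⟪v, w⟫_ℝ := by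
  rw [hj.skew, hj.sq, inner_neg_right, neg_neg]

end IsHermitianStructure

lemma exists_decomposition (hj : IsHermitianStructure j) {u : V} (hu : u ≠ 0) (v : V) :
    ∃ v', ⟪u, v'⟫_ℝ = 0 ∧ ⟪j u, v'⟫_ℝ = 0 ∧
      v = v' + (⟪u, v⟫_ℝ / ⟪u, u⟫_ℝ) • u + (⟪j u, v⟫_ℝ / ⟪u, u⟫_ℝ) • j u := by
  have hR : ⟪u, u⟫_ℝ ≠ 0 := inner_self_ne_zero.2 hu
  refine ⟨v - (⟪u, v⟫_ℝ / ⟪u, u⟫_ℝ) • u - (⟪j u, v⟫_ℝ / ⟪u, u⟫_ℝ) • j u, ?_, ?_, by abel⟩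
  · simp only [inner_sub_right, real_inner_smul_right, hj.inner_self_right]
    field_simp; ring
  · simp only [inner_sub_right, real_inner_smul_right, hj.inner_self_left, hj.inner_map_map]
    field_simp; ring

/-! ### The Codazzi equation -/

/-- The derivative of `⟪A w, x⟫` in the direction `v`, where
`A = k + U ⊗ b + b ⊗ U + σ jU ⊗ jU`; here `u` and `uv` stand for `U` and its derivative, and `l`,
`s`, `bv` for the derivatives of `k`, `σ`, `b`. -/
def hessianVariation (j : V →L[ℝ] V) (u b : V) (σ : ℝ) (uv : V) (l s : ℝ) (bv w x : V) : ℝ :=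
  l * ⟪w, x⟫_ℝ + (⟪uv, w⟫_ℝ * ⟪b, x⟫_ℝ + ⟪u, w⟫_ℝ * ⟪bv, x⟫_ℝ)
    + (⟪bv, w⟫_ℝ * ⟪u, x⟫_ℝ + ⟪b, w⟫_ℝ * ⟪uv, x⟫_ℝ)
    + (s * (⟪j u, w⟫_ℝ * ⟪j u, x⟫_ℝ)
      + σ * (⟪j uv, w⟫_ℝ * ⟪j u, x⟫_ℝ + ⟪j u, w⟫_ℝ * ⟪j uv, x⟫_ℝ))

/-- The Codazzi equation: the derivative of the symmetric field `A = DU - j` is symmetric in all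
arguments. -/
lemma hessianVariation_symm {j : V →L[ℝ] V} {U b : V → V} {A : V → V →L[ℝ] V} {k σ : V → ℝ} {z : V}
    {U' b' : V →L[ℝ] V} {l s : V →L[ℝ] ℝ} {A' : V →L[ℝ] V →L[ℝ] V}
    (hU : HasFDerivAt U U' z) (hA : HasFDerivAt A A' z) (hA' : ∀ v w, A' v w = A' w v)
    (hk : HasFDerivAt k l z) (hσ : HasFDerivAt σ s z) (hb : HasFDerivAt b b' z)
    (hform : ∀ᶠ y in 𝓝 z, ∀ w, A y w = k y • w + ⟪U y, w⟫_ℝ • b y + ⟪b y, w⟫_ℝ • U y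
      + (σ y * ⟪j (U y), w⟫_ℝ) • j (U y)) (v w x : V) :
    hessianVariation j (U z) (b z) (σ z) (U' v) (l v) (s v) (b' v) w x =
      hessianVariation j (U z) (b z) (σ z) (U' w) (l w) (s w) (b' w) v x := by
  have key : ∀ v w, hessianVariation j (U z) (b z) (σ z) (U' v) (l v) (s v) (b' v) w x
      = ⟪A' v w, x⟫_ℝ := by
    intro v w
    have h1 : HasFDerivAt (fun y => ⟪A y w, x⟫_ℝ) _ z :=
      (hA.clm_apply (hasFDerivAt_const w z)).inner ℝ (hasFDerivAt_const x z)
    have hjU : HasFDerivAt (fun y => j (U y)) (j.comp U') z := j.hasFDerivAt.comp z hU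
    have hin : ∀ {g : V → V} {g' : V →L[ℝ] V} (c : V), HasFDerivAt g g' z →
        HasFDerivAt (fun y => ⟪g y, c⟫_ℝ) _ z := fun c hg => hg.inner ℝ (hasFDerivAt_const c z)
    have h2 := (((hk.mul_const ⟪w, x⟫_ℝ).add ((hin w hU).mul (hin x hb))).add
      ((hin w hb).mul (hin x hU))).add (hσ.mul ((hin w hjU).mul (hin x hjU)))
    have h3 := h2.congr_of_eventuallyEq (f₁ := fun y => ⟪A y w, x⟫_ℝ) (by
      filter_upwards [hform] with y hy
      simp only [hy w, inner_add_left, real_inner_smul_left, Pi.add_apply, Pi.mul_apply]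
      ring)
    have h4 := congrArg (fun T : V →L[ℝ] ℝ => T v) (h1.unique h3)
    simp [fderivInnerCLM_apply] at h4
    rw [h4]
    simp only [hessianVariation]
    ring
  rw [key, key, hA']

section pointwise

variable {j : V →L[ℝ] V} {u b : V} {k σ m : ℝ} {D b' : V →L[ℝ] V} {l s : V →L[ℝ] ℝ}

/-- The Codazzi equations for arguments in the orthogonal complement of `u` and `j u`, and `j u`.
They show that `b` and the gradient of `k` lie in the span of `u` and `j u`, and determine their
`j u`-components. The hypotheses `hσ` and `hσ'` are the trace condition and its derivative. -/
lemma codazzi_perp (hj : IsHermitianStructure j) (hu : u ≠ 0) (hm : m ≠ 1)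
    (hD : ∀ v, D v = k • v + ⟪u, v⟫_ℝ • b + ⟪b, v⟫_ℝ • u + (σ * ⟪j u, v⟫_ℝ) • j u + j v)
    (hQ : ∀ v w x, hessianVariation j u b σ (D v) (l v) (s v) (b' v) w x =
      hessianVariation j u b σ (D w) (l w) (s w) (b' w) v x)
    (hσ : σ * ⟪u, u⟫_ℝ = -m * k)
    (hσ' : ∀ v, s v * ⟪u, u⟫_ℝ + σ * (2 * ⟪D v, u⟫_ℝ) = -m * l v)
    {w : V} (hw : ⟪w, w⟫_ℝ = 1) (huw : ⟪u, w⟫_ℝ = 0) (hjuw : ⟪j u, w⟫_ℝ = 0) :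
    ⟪b, w⟫_ℝ = 0 ∧ l w = 0 ∧ ⟪b, j u⟫_ℝ = m * k ^ 2 ∧ l (j u) = m * k * (1 + k ^ 2) := by
  have hR : ⟪u, u⟫_ℝ ≠ 0 := inner_self_ne_zero.2 hu
  set R := ⟪u, u⟫_ℝ with hRdef
  have e6 : ⟪j u, j u⟫_ℝ = R := by rw [hj.inner_map_map]
  -- The equation for the arguments `w`, `j u`, `j u`.
  have hl : ∀ w, ⟪u, w⟫_ℝ = 0 → ⟪j u, w⟫_ℝ = 0 → l w = ⟪b, w⟫_ℝ * k := by
    intro w huw hjuw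
    have hju_jw : ⟪j u, j w⟫_ℝ = 0 := by rw [hj.inner_map_map, huw]
    have e1 : ⟪w, u⟫_ℝ = 0 := by rw [real_inner_comm, huw]
    have e2 : ⟪w, j u⟫_ℝ = 0 := by rw [real_inner_comm, hjuw]
    have e3 : ⟪j w, u⟫_ℝ = 0 := by rw [hj.skew, e2, neg_zero]
    have e4 : ⟪j w, j u⟫_ℝ = 0 := by rw [real_inner_comm, hju_jw]
    have h := hQ w (j u) (j u)
    have h' := hσ' w
    simp only [hessianVariation, hD, map_add, map_smul, map_neg, hj.sq, inner_add_left,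
      real_inner_smul_left, inner_neg_left, hj.inner_self_left, hj.inner_self_right, huw, hjuw,
      e1, e2, e3, e4, e6, ← hRdef, smul_neg, neg_zero, mul_zero, zero_mul, add_zero, zero_add]
      at h h'
    have h0 : (1 - m) * R * (l w - ⟪b, w⟫_ℝ * k) = 0 := by
      linear_combination h - R * h' + R * ⟪b, w⟫_ℝ * hσ
    have h1 : (1 - m) * R ≠ 0 := mul_ne_zero (sub_ne_zero.2 hm.symm) hR
    exact sub_eq_zero.1 ((mul_eq_zero.1 h0).resolve_left h1)
  have hu_jw : ⟪u, j w⟫_ℝ = 0 := by have := hj.skew u w; linarith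
  have hju_jw : ⟪j u, j w⟫_ℝ = 0 := by rw [hj.inner_map_map, huw]
  have e2 : ⟪w, j u⟫_ℝ = 0 := by rw [real_inner_comm, hjuw]
  have e4 : ⟪j w, j u⟫_ℝ = 0 := by rw [real_inner_comm, hju_jw]
  have e5 : ⟪j w, j w⟫_ℝ = 1 := by rw [hj.inner_map_map, hw]
  -- Besides `hl` for `w` and `j w`, the equations for the arguments `w`, `j w`, `w`, for `w`,
  -- `j w`, `j u`, and for `j u`, `w`, `w`.
  have h1 := hl w huw hjuw
  have h2 := hl (j w) hu_jw hju_jw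
  have h3 := hQ w (j w) w
  have h4 := hQ w (j w) (j u)
  have h5 := hQ (j u) w w
  simp only [hessianVariation, hD, map_add, map_smul, map_neg, hj.sq, inner_add_left,
    real_inner_smul_left, inner_neg_left, hj.inner_self_left, hj.inner_self_right, huw, hjuw, e2,
    e4, e5, e6, hu_jw, hju_jw, hw, smul_neg, neg_zero, mul_zero, zero_mul, add_zero, zero_add]
    at h3 h4 h5
  have hbw : ⟪b, w⟫_ℝ = 0 := by linear_combination (1 / 3) * h3 + (1 / 3) * h2
  have hbju : ⟪b, j u⟫_ℝ = m * k ^ 2 := by linear_combination (1 / 2) * h4 - k * hσ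
  refine ⟨hbw, by rw [h1, hbw, zero_mul], hbju, ?_⟩
  linear_combination h5 + k * hbju - hσ

/-- Once `b = β j u + γ u` is known along with the derivative of this identity (`hb'`), the Codazzi
equations for the arguments `w`, `j w`, `u` and `u`, `w`, `w` determine `γ` and the `u`-component of
the gradient of `k`. -/
lemma codazzi_normal (hj : IsHermitianStructure j) (hu : u ≠ 0) {β γ : ℝ} {B G : V →L[ℝ] ℝ}
    (hD : ∀ v, D v = k • v + ⟪u, v⟫_ℝ • b + ⟪b, v⟫_ℝ • u + (σ * ⟪j u, v⟫_ℝ) • j u + j v)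
    (hQ : ∀ v w x, hessianVariation j u b σ (D v) (l v) (s v) (b' v) w x =
      hessianVariation j u b σ (D w) (l w) (s w) (b' w) v x)
    (hb : b = β • j u + γ • u) (hβ : β * ⟪u, u⟫_ℝ = m * k ^ 2)
    (hb' : ∀ v, b' v = (β • j (D v) + B v • j u) + (γ • D v + G v • u))
    {w : V} (hw : ⟪w, w⟫_ℝ = 1) (huw : ⟪u, w⟫_ℝ = 0) (hjuw : ⟪j u, w⟫_ℝ = 0) :
    2 * γ * ⟪u, u⟫_ℝ = -m * k ^ 3 ∧ l u = -m * k ^ 2 * (1 + k ^ 2) := by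
  have hR : ⟪u, u⟫_ℝ ≠ 0 := inner_self_ne_zero.2 hu
  set R := ⟪u, u⟫_ℝ with hRdef
  have hbw : ⟪b, w⟫_ℝ = 0 := by
    rw [hb, inner_add_left, real_inner_smul_left, real_inner_smul_left, huw, hjuw]; ring
  have hu_jw : ⟪u, j w⟫_ℝ = 0 := by have := hj.skew u w; linarith
  have hju_jw : ⟪j u, j w⟫_ℝ = 0 := by rw [hj.inner_map_map, huw]
  have hbjw : ⟪b, j w⟫_ℝ = 0 := by
    rw [hb, inner_add_left, real_inner_smul_left, real_inner_smul_left, hu_jw, hju_jw]; ring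
  have hbu : ⟪b, u⟫_ℝ = γ * R := by
    rw [hb, inner_add_left, real_inner_smul_left, real_inner_smul_left, hj.inner_self_left]; ring
  have e1 : ⟪w, u⟫_ℝ = 0 := by rw [real_inner_comm, huw]
  have e3 : ⟪j w, u⟫_ℝ = 0 := by rw [real_inner_comm, hu_jw]
  have e5 : ⟪j w, j w⟫_ℝ = 1 := by rw [hj.inner_map_map, hw]
  have h6 := hQ w (j w) u
  have h7 := hQ u w w
  simp only [hessianVariation, hb', hD, map_add, map_smul, map_neg, hj.sq, inner_add_left,
    real_inner_smul_left, inner_neg_left, hj.inner_self_left, hj.inner_self_right, huw, hjuw, e1,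
    e3, e5, hbw, hbjw, hbu, hu_jw, hju_jw, hw, ← hRdef, smul_neg, neg_zero, mul_zero, zero_mul,
    add_zero, zero_add] at h6 h7
  have hγ : 2 * γ * R = -m * k ^ 3 := by
    linear_combination (1 / 2) * h6 - k * hβ
  refine ⟨hγ, ?_⟩
  linear_combination h7 + k * hγ - hβ

end pointwise

/-! ### Umbilic fields with vanishing trace -/

variable {j : V →L[ℝ] V} {U : V → V} {A : V → V →L[ℝ] V} {m : ℝ} {z : V}

/-- The eigenvalue of `A` on the orthogonal complement of `U` and `jU`, read off from the trace
condition `⟪A jU, jU⟫ = (1 - m) k |U|²`. -/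
def scal (j : V →L[ℝ] V) (U : V → V) (A : V → V →L[ℝ] V) (m : ℝ) (z : V) : ℝ :=
  ⟪A z (j (U z)), j (U z)⟫_ℝ / ((1 - m) * ⟪U z, U z⟫_ℝ)

lemma scal_def (j : V →L[ℝ] V) (U : V → V) (A : V → V →L[ℝ] V) (m : ℝ) :
    scal j U A m =
      fun z => ⟪A z (j (U z)), j (U z)⟫_ℝ / ((1 - m) * ⟪U z, U z⟫_ℝ) := rfl

/-- The vector `b` in `A = k + U ⊗ b + b ⊗ U + σ jU ⊗ jU`. -/
def mixedVector (j : V →L[ℝ] V) (U : V → V) (A : V → V →L[ℝ] V) (m : ℝ) (z : V) : V :=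
  (⟪U z, U z⟫_ℝ)⁻¹ • (A z (U z)
    - ((⟪A z (U z), U z⟫_ℝ / ⟪U z, U z⟫_ℝ + scal j U A m z) / 2) • U z)

lemma mixedVector_def (j : V →L[ℝ] V) (U : V → V) (A : V → V →L[ℝ] V) (m : ℝ) :
    mixedVector j U A m = fun z => (⟪U z, U z⟫_ℝ)⁻¹ • (A z (U z)
      - ((⟪A z (U z), U z⟫_ℝ / ⟪U z, U z⟫_ℝ + scal j U A m z) / 2) • U z) := rfl

/-- The vector field `U = ∇f + jz` of a graph `t = f(z)`, whose derivative is `A + j` with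
`A` the Hessian of `f`, in the case of an umbilic graph with vanishing `p`-mean curvature:
where `U ≠ 0`, the form `A` is, modulo `U`, a multiple of the identity on the orthogonal complement
of `U` and `jU`, and its trace on the orthogonal complement of `U` vanishes. The latter space has
dimension `m`. -/
structure IsUmbilicMinimalField (j : V →L[ℝ] V) (U : V → V) (A : V → V →L[ℝ] V) (m : ℝ) :
    Prop where
  hermitian : IsHermitianStructure j
  ne_one : m ≠ 1
  exists_unit : ∀ u : V, ∃ w, ⟪w, w⟫_ℝ = 1 ∧ ⟪u, w⟫_ℝ = 0 ∧ ⟪j u, w⟫_ℝ = 0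
  hasFDerivAt : ∀ z, HasFDerivAt U (A z + j) z
  continuous : Continuous A
  symm : ∀ z v w, ⟪A z v, w⟫_ℝ = ⟪v, A z w⟫_ℝ
  differentiableAt : ∀ z, U z ≠ 0 → DifferentiableAt ℝ A z
  umbilic : ∀ z, U z ≠ 0 → ∀ w, ⟪U z, w⟫_ℝ = 0 → ⟪j (U z), w⟫_ℝ = 0 →
    ∃ c : ℝ, A z w = scal j U A m z • w + c • U z

namespace IsUmbilicMinimalField

/-- The umbilic form of `A`, with coefficients that depend differentiably on the point. -/
lemma apply_eq (h : IsUmbilicMinimalField j U A m) (hz : U z ≠ 0) (w : V) :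
    A z w = scal j U A m z • w + ⟪U z, w⟫_ℝ • mixedVector j U A m z
      + ⟪mixedVector j U A m z, w⟫_ℝ • U z
      + (-m * scal j U A m z / ⟪U z, U z⟫_ℝ * ⟪j (U z), w⟫_ℝ) • j (U z) := by
  have hj := h.hermitian
  have hR : ⟪U z, U z⟫_ℝ ≠ 0 := inner_self_ne_zero.2 hz
  have hm : (1 : ℝ) - m ≠ 0 := sub_ne_zero.2 h.ne_one.symm
  have hk : ⟪A z (j (U z)), j (U z)⟫_ℝ = (1 - m) * scal j U A m z * ⟪U z, U z⟫_ℝ := by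
    rw [scal]; field_simp
  obtain ⟨b, hb⟩ : ∃ b, b = mixedVector j U A m z := ⟨_, rfl⟩
  have hb' := hb
  rw [mixedVector] at hb'
  have humb := h.umbilic z hz
  have hsymm := h.symm z
  rw [← hb]
  generalize scal j U A m z = k at *
  generalize U z = u at *
  generalize A z = T at *
  have hbw : ∀ w, ⟪u, w⟫_ℝ = 0 → ⟪b, w⟫_ℝ = ⟪T u, w⟫_ℝ / ⟪u, u⟫_ℝ := by
    intro w hw
    rw [hb', real_inner_smul_left, inner_sub_left, real_inner_smul_left, hw]
    field_simp; ring
  -- The identity for vectors orthogonal to `u` and `j u`, for `u`, and for `j u`.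
  have h1 : ∀ w, ⟪u, w⟫_ℝ = 0 → ⟪j u, w⟫_ℝ = 0 → T w = k • w + ⟪b, w⟫_ℝ • u := by
    intro w hw hw'
    obtain ⟨c, hc⟩ := humb w hw hw'
    have : ⟪b, w⟫_ℝ = c := by
      rw [hbw w hw, hsymm, hc, inner_add_right, real_inner_smul_right, real_inner_smul_right, hw]
      field_simp; ring
    rw [this, hc]
  have h2 : T u = k • u + ⟪u, u⟫_ℝ • b + ⟪b, u⟫_ℝ • u := by
    have hbu : ⟪b, u⟫_ℝ = (⟪T u, u⟫_ℝ / ⟪u, u⟫_ℝ - k) / 2 := by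
      rw [hb', real_inner_smul_left, inner_sub_left, real_inner_smul_left]
      field_simp; ring
    rw [hbu, hb', smul_inv_smul₀ hR]
    module
  have h3 : T (j u) = ((1 - m) * k) • j u + ⟪b, j u⟫_ℝ • u := by
    have e1 : ⟪u, j u⟫_ℝ = 0 := hj.inner_self_right u
    have e2 : ⟪j u, j u⟫_ℝ = ⟪u, u⟫_ℝ := hj.inner_map_map u u
    obtain ⟨y, hy⟩ : ∃ y, y = T (j u) - ((1 - m) * k) • j u - ⟪b, j u⟫_ℝ • u := ⟨_, rfl⟩
    have hyu : ⟪u, y⟫_ℝ = 0 := by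
      rw [hy, inner_sub_right, inner_sub_right, real_inner_smul_right, real_inner_smul_right, e1,
        hbw _ e1, hsymm]
      field_simp; ring
    have hyju : ⟪j u, y⟫_ℝ = 0 := by
      rw [hy, inner_sub_right, inner_sub_right, real_inner_smul_right, real_inner_smul_right,
        hj.inner_self_left, e2, real_inner_comm, hk]
      ring
    have hyy : ⟪y, y⟫_ℝ = 0 := by
      nth_rw 1 [hy]
      rw [inner_sub_left, inner_sub_left, real_inner_smul_left, real_inner_smul_left, hyu, hyju,
        hsymm, h1 y hyu hyju, inner_add_right, real_inner_smul_right, real_inner_smul_right, hyju,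
        hj.inner_self_left]
      ring
    rw [inner_self_eq_zero] at hyy
    rw [hyy] at hy
    rw [eq_comm, sub_sub, sub_eq_zero] at hy
    exact hy
  obtain ⟨w', hw1, hw2, hw⟩ := exists_decomposition hj hz w
  generalize ⟪u, w⟫_ℝ / ⟪u, u⟫_ℝ = p at hw
  generalize ⟪j u, w⟫_ℝ / ⟪u, u⟫_ℝ = q at hw
  subst hw
  have e : -m * k / ⟪u, u⟫_ℝ * (q * ⟪u, u⟫_ℝ) = -m * k * q := by field_simp
  simp only [map_add, map_smul, h1 w' hw1 hw2, h2, h3, inner_add_right, real_inner_smul_right, hw1,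
    hw2, hj.inner_self_left, hj.inner_self_right, hj.inner_map_map, mul_zero, add_zero, zero_add, e]
  module

lemma differentiableAt_inner_self (h : IsUmbilicMinimalField j U A m) :
    DifferentiableAt ℝ (fun y => ⟪U y, U y⟫_ℝ) z :=
  (h.hasFDerivAt z).differentiableAt.inner ℝ (h.hasFDerivAt z).differentiableAt

lemma differentiableAt_scal (h : IsUmbilicMinimalField j U A m) (hz : U z ≠ 0) :
    DifferentiableAt ℝ (scal j U A m) z := by
  have hU := (h.hasFDerivAt z).differentiableAt
  have hA := h.differentiableAt z hz
  have hR := h.differentiableAt_inner_self (z := z)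
  have hjU : DifferentiableAt ℝ (fun y => j (U y)) z := j.differentiableAt.comp z hU
  have hN := (hA.clm_apply hjU).inner ℝ hjU
  simp only [scal_def, div_eq_mul_inv]
  refine hN.fun_mul ((hR.const_mul _).fun_inv ?_)
  exact mul_ne_zero (sub_ne_zero.2 h.ne_one.symm) (inner_self_ne_zero.2 hz)

lemma differentiableAt_mixedVector (h : IsUmbilicMinimalField j U A m) (hz : U z ≠ 0) :
    DifferentiableAt ℝ (mixedVector j U A m) z := by
  have hU := (h.hasFDerivAt z).differentiableAt
  have hA := h.differentiableAt z hz
  have hR := h.differentiableAt_inner_self (z := z)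
  have hR0 : ⟪U z, U z⟫_ℝ ≠ 0 := inner_self_ne_zero.2 hz
  have hAU := hA.clm_apply hU
  have hN := hAU.inner ℝ hU
  have hi := hR.fun_inv hR0
  simp only [mixedVector_def, div_eq_mul_inv]
  exact hi.fun_smul (hAU.fun_sub
    ((((hN.fun_mul hi).fun_add (h.differentiableAt_scal hz)).mul_const _).fun_smul hU))

lemma eventually_ne_zero (h : IsUmbilicMinimalField j U A m) (hz : U z ≠ 0) :
    ∀ᶠ y in 𝓝 z, U y ≠ 0 :=
  (h.hasFDerivAt z).continuousAt.eventually_ne hz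

/-- The derivative of `|U|²`. -/
lemma hasFDerivAt_inner_self (h : IsUmbilicMinimalField j U A m) :
    HasFDerivAt (fun y => ⟪U y, U y⟫_ℝ) ((2 : ℝ) • (innerSL ℝ (U z)).comp (A z + j)) z := by
  refine ((h.hasFDerivAt z).inner ℝ (h.hasFDerivAt z)).congr_fderiv ?_
  ext v
  simp only [ContinuousLinearMap.comp_apply, fderivInnerCLM_apply,
    ContinuousLinearMap.prod_apply, smul_apply, innerSL_apply_apply, smul_eq_mul]
  rw [real_inner_comm (U z)]
  ring

/-- The Codazzi equation of an umbilic field, with unspecified derivatives of the coefficients. -/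
lemma hessianVariation_symm (h : IsUmbilicMinimalField j U A m) (hz : U z ≠ 0) :
    ∃ s : V →L[ℝ] ℝ,
      (∀ v, s v * ⟪U z, U z⟫_ℝ + -m * scal j U A m z / ⟪U z, U z⟫_ℝ *
        (2 * ⟪(A z + j) v, U z⟫_ℝ) = -m * fderiv ℝ (scal j U A m) z v) ∧
      ∀ v w x, hessianVariation j (U z) (mixedVector j U A m z)
          (-m * scal j U A m z / ⟪U z, U z⟫_ℝ) ((A z + j) v) (fderiv ℝ (scal j U A m) z v) (s v)
          (fderiv ℝ (mixedVector j U A m) z v) w x =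
        hessianVariation j (U z) (mixedVector j U A m z)
          (-m * scal j U A m z / ⟪U z, U z⟫_ℝ) ((A z + j) w) (fderiv ℝ (scal j U A m) z w) (s w)
          (fderiv ℝ (mixedVector j U A m) z w) v x := by
  have hR0 : ⟪U z, U z⟫_ℝ ≠ 0 := inner_self_ne_zero.2 hz
  have hk := (h.differentiableAt_scal hz).hasFDerivAt
  have hb := (h.differentiableAt_mixedVector hz).hasFDerivAt
  have hA := (h.differentiableAt z hz).hasFDerivAt
  have hσd : DifferentiableAt ℝ (fun y => -m * scal j U A m y / ⟪U y, U y⟫_ℝ) z := by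
    simp only [div_eq_mul_inv]
    exact ((h.differentiableAt_scal hz).const_mul (-m)).fun_mul
      (h.differentiableAt_inner_self.fun_inv hR0)
  have hσ := hσd.hasFDerivAt
  refine ⟨fderiv ℝ (fun y => -m * scal j U A m y / ⟪U y, U y⟫_ℝ) z, fun v => ?_, ?_⟩
  · have h1 := (hσ.mul h.hasFDerivAt_inner_self).congr_of_eventuallyEq
      (f₁ := fun y => -m * scal j U A m y) (by
        filter_upwards [h.eventually_ne_zero hz] with y hy
        have : ⟪U y, U y⟫_ℝ ≠ 0 := inner_self_ne_zero.2 hy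
        simp only [Pi.mul_apply]
        field_simp)
    have h2 := congrArg (fun T : V →L[ℝ] ℝ => T v) (h1.unique (hk.const_mul (-m)))
    simp only [add_apply, smul_apply, smul_eq_mul,
      ContinuousLinearMap.comp_apply, innerSL_apply_apply] at h2
    rw [← h2, real_inner_comm (U z) ((A z + j) v)]
    simp only [add_apply]
    rw [add_comm, mul_comm ⟪U z, U z⟫_ℝ]
  · refine Heisenberg.hessianVariation_symm (h.hasFDerivAt z) hA ?_ hk hσ hb ?_
    · exact second_derivative_symmetric_of_eventually
        (Filter.Eventually.of_forall h.hasFDerivAt) (hA.add_const j)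
    · filter_upwards [h.eventually_ne_zero hz] with y hy using h.apply_eq hy

end IsUmbilicMinimalField

lemma hasDerivAt_inv_one_add_sq (t : ℝ) :
    HasDerivAt (fun t : ℝ => (1 + t ^ 2)⁻¹) (-(2 * t) / (1 + t ^ 2) ^ 2) t := by
  have h : HasDerivAt (fun t : ℝ => 1 + t ^ 2) (2 * t) t := by
    simpa using (hasDerivAt_pow 2 t).const_add 1
  exact h.fun_inv (by positivity)

lemma hasDerivAt_sq_div_one_add_sq_pow (m : ℕ) (t : ℝ) :
    HasDerivAt (fun t : ℝ => t ^ 2 / (1 + t ^ 2) ^ (m + 1))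
      (2 * t * (1 - m * t ^ 2) / (1 + t ^ 2) ^ (m + 2)) t := by
  have h : HasDerivAt (fun t : ℝ => 1 + t ^ 2) (2 * t) t := by
    simpa using (hasDerivAt_pow 2 t).const_add 1
  refine ((hasDerivAt_pow 2 t).fun_div (h.fun_pow (m + 1)) (by positivity)).congr_deriv ?_
  push_cast
  field_simp
  ring

namespace IsUmbilicMinimalField

lemma add_apply_eq (h : IsUmbilicMinimalField j U A m) (hz : U z ≠ 0) (w : V) :
    (A z + j) w = scal j U A m z • w + ⟪U z, w⟫_ℝ • mixedVector j U A m z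
      + ⟪mixedVector j U A m z, w⟫_ℝ • U z
      + (-m * scal j U A m z / ⟪U z, U z⟫_ℝ * ⟪j (U z), w⟫_ℝ) • j (U z) + j w := by
  rw [add_apply, h.apply_eq hz]

/-- The gradient of `k` and the mixed vector, except for their `U`-components. -/
lemma codazzi_perp (h : IsUmbilicMinimalField j U A m) (hz : U z ≠ 0) :
    (∀ w, ⟪U z, w⟫_ℝ = 0 → ⟪j (U z), w⟫_ℝ = 0 →
      ⟪mixedVector j U A m z, w⟫_ℝ = 0 ∧ fderiv ℝ (scal j U A m) z w = 0) ∧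
    ⟪mixedVector j U A m z, j (U z)⟫_ℝ = m * scal j U A m z ^ 2 ∧
    fderiv ℝ (scal j U A m) z (j (U z)) = m * scal j U A m z * (1 + scal j U A m z ^ 2) := by
  have hR0 : ⟪U z, U z⟫_ℝ ≠ 0 := inner_self_ne_zero.2 hz
  obtain ⟨s, hs, hQ⟩ := h.hessianVariation_symm hz
  have key := fun w => Heisenberg.codazzi_perp (w := w) h.hermitian hz h.ne_one
    (h.add_apply_eq hz) hQ (by field_simp) hs
  refine ⟨fun w huw hjuw => ?_, ?_⟩
  · rcases eq_or_ne w 0 with rfl | hw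
    · simp
    have hw' : ‖w‖ ≠ 0 := norm_ne_zero_iff.2 hw
    have := key (‖w‖⁻¹ • w) (by
        rw [real_inner_smul_left, real_inner_smul_right, real_inner_self_eq_norm_sq]; field_simp)
      (by rw [real_inner_smul_right, huw, mul_zero]) (by rw [real_inner_smul_right, hjuw, mul_zero])
    rw [real_inner_smul_right, map_smul, smul_eq_mul] at this
    exact ⟨(mul_eq_zero.1 this.1).resolve_left (inv_ne_zero hw'),
      (mul_eq_zero.1 this.2.1).resolve_left (inv_ne_zero hw')⟩
  · obtain ⟨w, hw, huw, hjuw⟩ := h.exists_unit (U z)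
    exact (key w hw huw hjuw).2.2

/-- The mixed vector has no component in the orthogonal complement of `U` and `jU`. -/
lemma mixedVector_eq (h : IsUmbilicMinimalField j U A m) (hz : U z ≠ 0) :
    mixedVector j U A m z = (m * scal j U A m z ^ 2 / ⟪U z, U z⟫_ℝ) • j (U z)
      + (⟪mixedVector j U A m z, U z⟫_ℝ / ⟪U z, U z⟫_ℝ) • U z := by
  obtain ⟨h1, h2, -⟩ := h.codazzi_perp hz
  obtain ⟨w, huw, hjuw, hw⟩ := exists_decomposition h.hermitian hz (mixedVector j U A m z)
  have hw0 : w = 0 := by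
    have := (h1 w huw hjuw).1
    rwa [hw, inner_add_left, inner_add_left, real_inner_smul_left, real_inner_smul_left, huw, hjuw,
      mul_zero, mul_zero, add_zero, add_zero, inner_self_eq_zero] at this
  rw [hw0, zero_add, real_inner_comm, real_inner_comm _ (j (U z)), h2, add_comm] at hw
  exact hw

/-- The `U`-components of the gradient of `k` and of the mixed vector. -/
lemma codazzi_normal (h : IsUmbilicMinimalField j U A m) (hz : U z ≠ 0) :
    2 * ⟪mixedVector j U A m z, U z⟫_ℝ = -m * scal j U A m z ^ 3 ∧
    fderiv ℝ (scal j U A m) z (U z) = -m * scal j U A m z ^ 2 * (1 + scal j U A m z ^ 2) := by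
  have hR0 : ⟪U z, U z⟫_ℝ ≠ 0 := inner_self_ne_zero.2 hz
  obtain ⟨s, hs, hQ⟩ := h.hessianVariation_symm hz
  obtain ⟨w, hw, huw, hjuw⟩ := h.exists_unit (U z)
  have hU := h.hasFDerivAt z
  have hk := h.differentiableAt_scal hz
  have hR := h.differentiableAt_inner_self (z := z)
  have hb := h.differentiableAt_mixedVector hz
  have hβ : DifferentiableAt ℝ (fun y => m * scal j U A m y ^ 2 / ⟪U y, U y⟫_ℝ) z := by
    simp only [div_eq_mul_inv]
    exact ((hk.fun_pow 2).const_mul m).fun_mul (hR.fun_inv hR0)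
  have hγ : DifferentiableAt ℝ (fun y => ⟪mixedVector j U A m y, U y⟫_ℝ / ⟪U y, U y⟫_ℝ) z := by
    simp only [div_eq_mul_inv]
    exact (hb.inner ℝ hU.differentiableAt).fun_mul (hR.fun_inv hR0)
  have hjU : HasFDerivAt (fun y => j (U y)) (j.comp (A z + j)) z := j.hasFDerivAt.comp z hU
  have hsum := ((hβ.hasFDerivAt.fun_smul hjU).fun_add (hγ.hasFDerivAt.fun_smul hU))
  have hb' := (hsum.congr_of_eventuallyEq (f₁ := mixedVector j U A m) (by
    filter_upwards [h.eventually_ne_zero hz] with y hy using h.mixedVector_eq hy)).fderiv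
  have := Heisenberg.codazzi_normal (w := w) (m := m) h.hermitian hz (h.add_apply_eq hz) hQ
    (h.mixedVector_eq hz) (by field_simp) (fun v => by rw [hb']; rfl) hw huw hjuw
  refine ⟨?_, this.2⟩
  rw [← this.1]
  field_simp

/-! ### First integrals -/

/-- The direction `ν = jU - kU`, in which alone `k` varies. -/
def slope (j : V →L[ℝ] V) (U : V → V) (A : V → V →L[ℝ] V) (m : ℝ) (z : V) : V :=
  j (U z) - scal j U A m z • U z

/-- The form `A` is a combination of the identity and `ν ⊗ ν`. -/
lemma apply_eq_slope (h : IsUmbilicMinimalField j U A m) (hz : U z ≠ 0) (v : V) :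
    A z v = scal j U A m z • v
      - (m * scal j U A m z * (⟪slope j U A m z, v⟫_ℝ / ⟪U z, U z⟫_ℝ)) • slope j U A m z := by
  have hR0 : ⟪U z, U z⟫_ℝ ≠ 0 := inner_self_ne_zero.2 hz
  have hb := h.mixedVector_eq hz
  have hbU : ⟪mixedVector j U A m z, U z⟫_ℝ = -m * scal j U A m z ^ 3 / 2 := by
    have := (h.codazzi_normal hz).1
    linarith
  rw [h.apply_eq hz, hb, hbU]
  simp only [slope, inner_add_left, inner_sub_left, real_inner_smul_left]
  generalize ⟪U z, U z⟫_ℝ = R at *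
  match_scalars <;> field_simp <;> ring

/-- The gradient of `k` is a multiple of `ν`. -/
lemma fderiv_scal (h : IsUmbilicMinimalField j U A m) (hz : U z ≠ 0) (v : V) :
    fderiv ℝ (scal j U A m) z v = m * scal j U A m z * (1 + scal j U A m z ^ 2)
      * (⟪slope j U A m z, v⟫_ℝ / ⟪U z, U z⟫_ℝ) := by
  have hR0 : ⟪U z, U z⟫_ℝ ≠ 0 := inner_self_ne_zero.2 hz
  obtain ⟨h1, -, h2⟩ := h.codazzi_perp hz
  have h3 := (h.codazzi_normal hz).2
  obtain ⟨w, huw, hjuw, hw⟩ := exists_decomposition h.hermitian hz v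
  rw [hw, map_add, map_add, map_smul, map_smul, (h1 w huw hjuw).2, h2, h3, ← hw]
  simp only [slope, inner_sub_left, real_inner_smul_left, smul_eq_mul]
  field_simp
  ring

/-- The first integral `z + ν / (1 + k²)`: the centre of the spheres on which `k` is constant. -/
def centre (j : V →L[ℝ] V) (U : V → V) (A : V → V →L[ℝ] V) (m : ℝ) (z : V) : V :=
  z + (1 + scal j U A m z ^ 2)⁻¹ • slope j U A m z

lemma hasFDerivAt_centre (h : IsUmbilicMinimalField j U A m) (hz : U z ≠ 0) :
    HasFDerivAt (centre j U A m) (0 : V →L[ℝ] V) z := by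
  have hU := h.hasFDerivAt z
  have hk := (h.differentiableAt_scal hz).hasFDerivAt
  have hjU : HasFDerivAt (fun y => j (U y)) (j.comp (A z + j)) z := j.hasFDerivAt.comp z hU
  have hν := hjU.fun_sub (hk.fun_smul hU)
  have hinv := (hasDerivAt_inv_one_add_sq (scal j U A m z)).comp_hasFDerivAt z hk
  have hC : HasFDerivAt (centre j U A m) _ z := (hasFDerivAt_id z).fun_add (hinv.fun_smul hν)
  refine hC.congr_fderiv (ContinuousLinearMap.ext fun v => ?_)
  have hR0 : ⟪U z, U z⟫_ℝ ≠ 0 := inner_self_ne_zero.2 hz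
  have hk2 : (1 : ℝ) + scal j U A m z ^ 2 ≠ 0 := by positivity
  simp only [add_apply, sub_apply, smul_apply, ContinuousLinearMap.comp_apply,
    ContinuousLinearMap.smulRight_apply, ContinuousLinearMap.id_apply, zero_apply,
    Function.comp_apply, h.fderiv_scal hz, h.apply_eq_slope hz, smul_eq_mul]
  generalize ⟪slope j U A m z, v⟫_ℝ / ⟪U z, U z⟫_ℝ = q
  simp only [slope, map_add, map_sub, map_smul, h.hermitian.sq]
  match_scalars <;> field_simp <;> ring

/-- The first integral `|U|²ᵐ k² / (1 + k²)ᵐ⁺¹`. -/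
def energy (j : V →L[ℝ] V) (U : V → V) (A : V → V →L[ℝ] V) (m : ℕ) (z : V) : ℝ :=
  ⟪U z, U z⟫_ℝ ^ m * (scal j U A m z ^ 2 / (1 + scal j U A m z ^ 2) ^ (m + 1))

lemma hasFDerivAt_energy {m : ℕ} (h : IsUmbilicMinimalField j U A m) (hz : U z ≠ 0) :
    HasFDerivAt (energy j U A m) (0 : V →L[ℝ] ℝ) z := by
  have hj := h.hermitian
  have hk := (h.differentiableAt_scal hz).hasFDerivAt
  have hpow := (hasDerivAt_pow m ⟪U z, U z⟫_ℝ).comp_hasFDerivAt z h.hasFDerivAt_inner_self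
  have hquot := (hasDerivAt_sq_div_one_add_sq_pow m (scal j U A m z)).comp_hasFDerivAt z hk
  have hE : HasFDerivAt (energy j U A m) _ z := hpow.fun_mul hquot
  refine hE.congr_fderiv (ContinuousLinearMap.ext fun v => ?_)
  have hR0 : ⟪U z, U z⟫_ℝ ≠ 0 := inner_self_ne_zero.2 hz
  have hk2 : (1 : ℝ) + scal j U A m z ^ 2 ≠ 0 := by positivity
  have hDR : ((2 : ℝ) • (innerSL ℝ (U z)).comp (A z + j)) v =
      2 * (⟪slope j U A m z, v⟫_ℝ / ⟪U z, U z⟫_ℝ) * ⟪U z, U z⟫_ℝ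
        * (m * scal j U A m z ^ 2 - 1) := by
    have h1 : ⟪U z, slope j U A m z⟫_ℝ = -(scal j U A m z * ⟪U z, U z⟫_ℝ) := by
      rw [slope, inner_sub_right, hj.inner_self_right, real_inner_smul_right, zero_sub]
    have h2 : ⟪U z, j v⟫_ℝ = -(⟪slope j U A m z, v⟫_ℝ + scal j U A m z * ⟪U z, v⟫_ℝ) := by
      rw [slope, inner_sub_left, hj.skew, real_inner_smul_left]
      ring
    simp only [smul_apply, ContinuousLinearMap.comp_apply, innerSL_apply_apply, add_apply,
      h.apply_eq_slope hz, inner_add_right, inner_sub_right, real_inner_smul_right, h1, h2,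
      smul_eq_mul]
    field_simp
    ring
  rw [add_apply, smul_apply, smul_apply, smul_apply, smul_apply, hDR, h.fderiv_scal hz]
  generalize ⟪slope j U A m z, v⟫_ℝ / ⟪U z, U z⟫_ℝ = q
  simp only [Function.comp_apply, smul_eq_mul, zero_apply]
  generalize ⟪U z, U z⟫_ℝ = R at *
  generalize scal j U A m z = k at *
  cases m with
  | zero => simp
  | succ m =>
    rw [add_tsub_cancel_right]
    push_cast
    field_simp
    ring

end IsUmbilicMinimalField

/-! ### Vanishing of the Hessian -/

/-- A function whose derivative vanishes near a point is constant near this point. -/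
lemma eventually_eq_of_hasFDerivAt_zero {W F : Type*} [NormedAddCommGroup W] [NormedSpace ℝ W]
    [NormedAddCommGroup F] [NormedSpace ℝ F] {g : W → F} {y : W}
    (h : ∀ᶠ x in 𝓝 y, HasFDerivAt g (0 : W →L[ℝ] F) x) : ∀ᶠ x in 𝓝 y, g x = g y := by
  obtain ⟨r, hr, hball⟩ := Metric.eventually_nhds_iff_ball.1 h
  filter_upwards [Metric.ball_mem_nhds y hr] with x hx
  exact Metric.isOpen_ball.is_const_of_fderiv_eq_zero (𝕜 := ℝ) (convex_ball y r).isPreconnected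
    (fun x hx => (hball x hx).differentiableAt.differentiableWithinAt)
    (fun x hx => (hball x hx).fderiv) hx (Metric.mem_ball_self hr)

namespace IsUmbilicMinimalField

lemma inner_slope_self (h : IsHermitianStructure j) (m : ℝ) (z : V) :
    ⟪slope j U A m z, slope j U A m z⟫_ℝ = (1 + scal j U A m z ^ 2) * ⟪U z, U z⟫_ℝ := by
  simp only [slope, inner_sub_left, inner_sub_right, real_inner_smul_left, real_inner_smul_right,
    h.inner_map_map, h.inner_self_left, h.inner_self_right]
  ring

lemma centre_ne_self {m : ℝ} (h : IsUmbilicMinimalField j U A m) (hz : U z ≠ 0) :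
    centre j U A m z ≠ z := by
  intro heq
  have hk2 : (1 : ℝ) + scal j U A m z ^ 2 ≠ 0 := by positivity
  have h0 : slope j U A m z = 0 := by
    rw [centre, add_eq_left] at heq
    exact (smul_eq_zero.1 heq).resolve_left (inv_ne_zero hk2)
  have h1 := inner_slope_self (U := U) (A := A) h.hermitian m z
  rw [h0, inner_zero_left, eq_comm] at h1
  exact hz (inner_self_eq_zero.1 ((mul_eq_zero.1 h1).resolve_left hk2))

/-- If `k` does not vanish at `z`, then the two first integrals are constant on a set which is open,
and closed because the energy keeps it away from the zeros of `U`. Hence this set is the whole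
space; but its centre cannot belong to it. -/
lemma scal_eq_zero {m : ℕ} (h : IsUmbilicMinimalField j U A m) (hm : m ≠ 0) (hz : U z ≠ 0) :
    scal j U A m z = 0 := by
  by_contra hk
  have hEpos : 0 < energy j U A m z := by
    have : 0 < ⟪U z, U z⟫_ℝ := real_inner_self_pos.2 hz
    have : 0 < scal j U A m z ^ 2 := by positivity
    unfold energy
    positivity
  have hle : ∀ y, energy j U A m y ≤ ⟪U y, U y⟫_ℝ ^ m := by
    intro y
    refine mul_le_of_le_one_right (pow_nonneg real_inner_self_nonneg m) ?_
    rw [div_le_one (by positivity)]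
    calc scal j U A m y ^ 2 ≤ 1 + scal j U A m y ^ 2 := by linarith
      _ ≤ (1 + scal j U A m y ^ 2) ^ (m + 1) :=
        le_self_pow₀ (by nlinarith [sq_nonneg (scal j U A m y)]) (by omega)
  let S : Set V := {y | U y ≠ 0 ∧ centre j U A m y = centre j U A m z ∧
    energy j U A m y = energy j U A m z}
  have hopen : IsOpen S := by
    rw [isOpen_iff_mem_nhds]
    rintro y ⟨hy, hy1, hy2⟩
    have hev := h.eventually_ne_zero hy
    filter_upwards [hev, eventually_eq_of_hasFDerivAt_zero (hev.mono fun x => h.hasFDerivAt_centre),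
      eventually_eq_of_hasFDerivAt_zero (hev.mono fun x => h.hasFDerivAt_energy)] with x hx hx1 hx2
    exact ⟨hx, hx1.trans hy1, hx2.trans hy2⟩
  have hclosed : IsClosed S := by
    have hUc : Continuous U := continuous_iff_continuousAt.2 fun y => (h.hasFDerivAt y).continuousAt
    have hcl : IsClosed {y | energy j U A m z ≤ ⟪U y, U y⟫_ℝ ^ m} :=
      isClosed_le continuous_const ((hUc.inner hUc).pow m)
    refine isClosed_of_closure_subset fun y hy => ?_
    have hy0 : U y ≠ 0 := by
      have hmem := closure_minimal (fun x hx => by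
        rw [Set.mem_ofPred_eq, ← hx.2.2]; exact hle x) hcl hy
      intro h0
      rw [Set.mem_ofPred_eq, h0, inner_zero_left, zero_pow hm] at hmem
      linarith
    have hfreq := mem_closure_iff_frequently.1 hy
    refine ⟨hy0, ?_, ?_⟩
    · by_contra hne
      obtain ⟨x, hx, hx'⟩ :=
        (hfreq.and_eventually ((h.hasFDerivAt_centre hy0).continuousAt.eventually_ne hne)).exists
      exact hx' hx.2.1
    · by_contra hne
      obtain ⟨x, hx, hx'⟩ :=
        (hfreq.and_eventually ((h.hasFDerivAt_energy hy0).continuousAt.eventually_ne hne)).exists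
      exact hx' hx.2.2
  have huniv : S = Set.univ := IsClopen.eq_univ ⟨hclosed, hopen⟩ ⟨z, hz, rfl, rfl⟩
  have hc : centre j U A m z ∈ S := huniv ▸ Set.mem_univ _
  exact h.centre_ne_self hc.1 hc.2.1

/-- The zeros of `U` have no interior: there `A` would be `-j`, which is not symmetric. -/
lemma dense_ne_zero {m : ℝ} (h : IsUmbilicMinimalField j U A m) : Dense {y | U y ≠ 0} := by
  intro y
  by_contra hy
  rw [mem_closure_iff_frequently, Filter.not_frequently] at hy
  have hev : U =ᶠ[𝓝 y] fun _ => (0 : V) := hy.mono fun x hx => not_not.1 hx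
  have hA : A y + j = 0 := ((h.hasFDerivAt y).congr_of_eventuallyEq hev.symm).unique
    (hasFDerivAt_const 0 y)
  obtain ⟨w, hw, -, -⟩ := h.exists_unit 0
  have h1 : ∀ v, A y v = -j v := fun v => eq_neg_of_add_eq_zero_left (congrArg (fun T => T v) hA)
  have h2 := h.symm y w (j w)
  rw [h1, h1, h.hermitian.sq, neg_neg, inner_neg_left, h.hermitian.inner_map_map, hw] at h2
  norm_num at h2

theorem eq_zero {m : ℕ} (h : IsUmbilicMinimalField j U A m) (hm : m ≠ 0) (z : V) : A z = 0 := by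
  have hcl : IsClosed {y | A y = 0} := isClosed_eq h.continuous continuous_const
  refine closure_minimal (fun y hy => ?_) hcl (h.dense_ne_zero z)
  ext v
  rw [h.apply_eq_slope hy, h.scal_eq_zero hm hy]
  simp

end IsUmbilicMinimalField

end umbilicField

/-! ### Graphs in the Heisenberg group -/

variable {n : ℕ}

local notation "E" n => EuclideanSpace ℂ (Fin n)

/-- A symmetric operator with at most one eigenvalue is a multiple of the identity. -/
lemma eq_smul_of_unique_eigenvalue {P : Type*} [NormedAddCommGroup P] [InnerProductSpace ℝ P]
    [FiniteDimensional ℝ P] {T : P →ₗ[ℝ] P} (hT : T.IsSymmetric) {k : ℝ}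
    (h : ∀ (μ : ℝ) (w : P), w ≠ 0 → T w = μ • w → μ = k) (w : P) : T w = k • w := by
  have hb : T = k • LinearMap.id := by
    refine (hT.eigenvectorBasis rfl).toBasis.ext fun i => ?_
    have h1 := hT.apply_eigenvectorBasis rfl i
    have h2 := h _ _ ((hT.eigenvectorBasis rfl).orthonormal.ne_zero i) h1
    simp [h1, h2]
  rw [hb]
  rfl

/-- Multiplication by `i` on `ℂⁿ`. -/
def mulI (n : ℕ) : (E n) →L[ℝ] (E n) :=
  (Complex.I • ContinuousLinearMap.id ℂ (E n)).restrictScalars ℝ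

@[simp] lemma mulI_apply (v : E n) : mulI n v = Complex.I • v := rfl

lemma inner_eq (v w : E n) :
    ⟪v, w⟫_ℝ = ∑ i, ((v i).re * (w i).re + (v i).im * (w i).im) := by
  simp [PiLp.inner_apply, Complex.inner, mul_comm]

lemma levi_eq (v w : Heis n) : levi v w = ⟪v.1, w.1⟫_ℝ := (inner_eq _ _).symm

lemma isHermitianStructure_mulI : IsHermitianStructure (mulI n) where
  sq v := by simp [smul_smul]
  skew v w := by
    simp only [inner_eq, mulI_apply, ← Finset.sum_neg_distrib, PiLp.smul_apply, smul_eq_mul,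
      Complex.mul_re, Complex.mul_im, Complex.I_re, Complex.I_im]
    exact Finset.sum_congr rfl fun i _ => by ring

lemma contactForm_eq (p v : Heis n) : contactForm p v = v.2 + ⟪mulI n p.1, v.1⟫_ℝ := by
  simp only [contactForm, LinearMap.coe_mk, AddHom.coe_mk, inner_eq, mulI_apply, PiLp.smul_apply,
    smul_eq_mul, Complex.mul_re, Complex.mul_im, Complex.I_re, Complex.I_im]
  congr 1
  exact Finset.sum_congr rfl fun i _ => by ring

lemma horizontalVector_eq (p : Heis n) (c : E n) :
    horizontalVector p c = (c, -⟪mulI n p.1, c⟫_ℝ) := by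
  simp only [horizontalVector, inner_eq, mulI_apply, PiLp.smul_apply, ← Finset.sum_neg_distrib,
    smul_eq_mul, Complex.mul_re, Complex.mul_im, Complex.I_re, Complex.I_im]
  congr 1
  exact Finset.sum_congr rfl fun i _ => by ring

lemma mem_contactSpace {p v : Heis n} : v ∈ contactSpace p ↔ v.2 + ⟪mulI n p.1, v.1⟫_ℝ = 0 := by
  rw [contactSpace, LinearMap.mem_ker, contactForm_eq]

lemma J_eq (p v : Heis n) : J p v = (mulI n v.1, -⟪mulI n p.1, mulI n v.1⟫_ℝ) :=
  horizontalVector_eq p _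

lemma finrank_euclideanSpace_complex : Module.finrank ℝ (E n) = 2 * n := by
  rw [finrank_real_of_complex, finrank_euclideanSpace_fin]

/-- In complex dimension at least two, some unit vector is orthogonal to a given complex line. -/
lemma exists_unit_perp (hn : 2 ≤ n) (u : E n) :
    ∃ w, ⟪w, w⟫_ℝ = 1 ∧ ⟪u, w⟫_ℝ = 0 ∧ ⟪mulI n u, w⟫_ℝ = 0 := by
  classical
  let P := Submodule.span ℝ (({u, mulI n u} : Finset (E n)) : Set (E n))
  have hP : Pᗮ ≠ ⊥ := by
    intro hbot
    rw [Submodule.orthogonal_eq_bot_iff] at hbot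
    have h1 : Module.finrank ℝ P ≤ 2 := (finrank_span_finset_le_card _).trans Finset.card_le_two
    rw [hbot, finrank_top, finrank_euclideanSpace_complex] at h1
    omega
  obtain ⟨w, hw, hw0⟩ := Submodule.exists_mem_ne_zero_of_ne_bot hP
  have hw' : ‖w‖ ≠ 0 := norm_ne_zero_iff.2 hw0
  have hperp := (Submodule.mem_orthogonal P w).1 hw
  refine ⟨‖w‖⁻¹ • w, ?_, ?_, ?_⟩
  · rw [real_inner_smul_left, real_inner_smul_right, real_inner_self_eq_norm_sq]
    field_simp
  · rw [real_inner_smul_right, hperp u (Submodule.subset_span (by simp)), mul_zero]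
  · rw [real_inner_smul_right, hperp (mulI n u) (Submodule.subset_span (by simp)), mul_zero]

/-- The Riesz isomorphism of `ℂⁿ` with its real dual. -/
def riesz (n : ℕ) : ((E n) →L[ℝ] ℝ) →L[ℝ] (E n) :=
  LinearMap.toContinuousLinearMap
    { toFun := fun φ => (InnerProductSpace.toDual ℝ (E n)).symm φ
      map_add' := fun φ ψ => map_add _ φ ψ
      map_smul' := fun c φ => by simp }

lemma inner_riesz (φ : (E n) →L[ℝ] ℝ) (w : E n) : ⟪riesz n φ, w⟫_ℝ = φ w :=
  InnerProductSpace.toDual_symm_apply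

/-- The field `U = ∇f + i z`, for which `Θ` restricted to the graph `t = f(z)` is `⟪U, dz⟫`. -/
def graphField (f : (E n) → ℝ) (z : E n) : E n := riesz n (fderiv ℝ f z) + mulI n z

/-- The Hessian of `f`. -/
def graphHessian (f : (E n) → ℝ) (z : E n) : (E n) →L[ℝ] (E n) :=
  (riesz n).comp (fderiv ℝ (fderiv ℝ f) z)

section graph

variable {f : (E n) → ℝ} {z : E n}

lemma inner_graphField (w : E n) :
    ⟪graphField f z, w⟫_ℝ = fderiv ℝ f z w + ⟪mulI n z, w⟫_ℝ := by
  rw [graphField, inner_add_left, inner_riesz]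

lemma hasFDerivAt_graphField (hf : ContDiff ℝ 2 f) (z : E n) :
    HasFDerivAt (graphField f) (graphHessian f z + mulI n) z := by
  have h1 : DifferentiableAt ℝ (fderiv ℝ f) z :=
    ((hf.fderiv_right (m := 1) le_rfl).differentiable one_ne_zero) z
  exact ((riesz n).hasFDerivAt.comp z h1.hasFDerivAt).add (mulI n).hasFDerivAt

lemma continuous_graphHessian (hf : ContDiff ℝ 2 f) : Continuous (graphHessian f) := by
  have h1 : Continuous (fderiv ℝ (fderiv ℝ f)) :=
    (hf.fderiv_right (m := 1) le_rfl).continuous_fderiv one_ne_zero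
  exact continuous_const.clm_comp h1

lemma graphHessian_symm (hf : ContDiff ℝ 2 f) (v w : E n) :
    ⟪graphHessian f z v, w⟫_ℝ = ⟪v, graphHessian f z w⟫_ℝ := by
  have h := (hf.contDiffAt (x := z)).isSymmSndFDerivAt (by simp)
  rw [real_inner_comm (graphHessian f z w) v]
  simp only [graphHessian, ContinuousLinearMap.comp_apply, inner_riesz]
  exact h v w

lemma differentiableAt_graphHessian (hf : ContDiffAt ℝ ∞ f z) :
    DifferentiableAt ℝ (graphHessian f) z := by
  have h3 : ContDiffAt ℝ 3 f z := by exact_mod_cast contDiffAt_infty.1 hf 3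
  have h1 : ContDiffAt ℝ 2 (fderiv ℝ f) z := h3.fderiv_right (by norm_num)
  have h2 : ContDiffAt ℝ 1 (fderiv ℝ (fderiv ℝ f)) z := h1.fderiv_right le_rfl
  exact (differentiableAt_const (riesz n)).clm_comp (h2.differentiableAt one_ne_zero)

lemma hasFDerivAt_graphMap (hf : ContDiff ℝ 2 f) (z : E n) :
    HasFDerivAt (graphMap f) ((ContinuousLinearMap.id ℝ (E n)).prod (fderiv ℝ f z)) z :=
  (hasFDerivAt_id z).prodMk ((hf.differentiable two_ne_zero) z).hasFDerivAt

lemma fderiv_graphMap (hf : ContDiff ℝ 2 f) (z w : E n) :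
    fderiv ℝ (graphMap f) z w = (w, fderiv ℝ f z w) := by
  rw [(hasFDerivAt_graphMap hf z).fderiv]
  rfl

lemma mem_tangentSpace_graphMap (hf : ContDiff ℝ 2 f) {v : Heis n} :
    v ∈ tangentSpace (graphMap f) z ↔ v.2 = fderiv ℝ f z v.1 := by
  rw [tangentSpace, LinearMap.mem_range]
  constructor
  · rintro ⟨w, rfl⟩
    rw [ContinuousLinearMap.coe_coe, fderiv_graphMap hf]
  · intro h
    exact ⟨v.1, by rw [ContinuousLinearMap.coe_coe, fderiv_graphMap hf, ← h]⟩

lemma mem_horizontalTangent_graphMap (hf : ContDiff ℝ 2 f) {v : Heis n} :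
    v ∈ horizontalTangent (graphMap f) z ↔
      v.2 = fderiv ℝ f z v.1 ∧ ⟪graphField f z, v.1⟫_ℝ = 0 := by
  rw [horizontalTangent, Submodule.mem_inf, mem_tangentSpace_graphMap hf, mem_contactSpace,
    inner_graphField, and_comm]
  refine and_congr_right fun h => ?_
  rw [h]
  rfl

lemma mem_xiPrime_graphMap (hf : ContDiff ℝ 2 f) {v : Heis n} :
    v ∈ xiPrime (graphMap f) z ↔ v.2 = fderiv ℝ f z v.1 ∧ ⟪graphField f z, v.1⟫_ℝ = 0 ∧
      ⟪mulI n (graphField f z), v.1⟫_ℝ = 0 := by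
  have hj := isHermitianStructure_mulI (n := n)
  rw [xiPrime, Submodule.mem_inf, mem_horizontalTangent_graphMap hf, and_assoc]
  refine and_congr_right fun h1 => and_congr_right fun h2 => ?_
  rw [Submodule.mem_map]
  constructor
  · rintro ⟨u, hu, rfl⟩
    rw [J_eq, hj.inner_map_map]
    exact ((mem_horizontalTangent_graphMap hf).1 hu).2
  · intro h3
    have h4 : ⟪graphField f z, mulI n v.1⟫_ℝ = 0 := by
      have := hj.skew (graphField f z) v.1
      linarith
    refine ⟨(-mulI n v.1, fderiv ℝ f z (-mulI n v.1)),
      (mem_horizontalTangent_graphMap hf).2 ⟨rfl, ?_⟩, ?_⟩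
    · rw [inner_neg_right, h4, neg_zero]
    · rw [J_eq]
      refine Prod.ext ?_ ?_
      · simp only [map_neg, hj.sq, neg_neg]
      · rw [inner_graphField] at h2
        simp only [map_neg, hj.sq, neg_neg, graphMap]
        linarith

lemma isRegularPoint_graphMap (hf : ContDiff ℝ 2 f) (hz : graphField f z ≠ 0) :
    IsRegularPoint (graphMap f) z := by
  intro heq
  have h1 : fderiv ℝ (graphMap f) z (graphField f z) ∈ tangentSpace (graphMap f) z :=
    LinearMap.mem_range_self _ _
  rw [← heq, mem_contactSpace, fderiv_graphMap hf] at h1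
  exact hz (inner_self_eq_zero.1 ((inner_graphField _).trans h1))

end graph

/-! ### The shape operator of a graph -/

section shape

variable {f : (E n) → ℝ} {z : E n}

/-- A vector orthogonal to `U` and to `ξ'` is a multiple of `iU`. -/
lemma mulI_eq_smul_of_perp {u v : E n} (hu : u ≠ 0) (huv : ⟪u, v⟫_ℝ = 0)
    (h : ∀ w, ⟪u, w⟫_ℝ = 0 → ⟪mulI n u, w⟫_ℝ = 0 → ⟪v, w⟫_ℝ = 0) :
    mulI n v = (-(⟪mulI n u, v⟫_ℝ / ⟪u, u⟫_ℝ)) • u := by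
  have hj := isHermitianStructure_mulI (n := n)
  obtain ⟨w, huw, hjuw, hv⟩ := exists_decomposition hj hu v
  have hw0 : w = 0 := by
    have := h w huw hjuw
    rwa [hv, inner_add_left, inner_add_left, real_inner_smul_left, real_inner_smul_left, huw, hjuw,
      mul_zero, mul_zero, add_zero, add_zero, inner_self_eq_zero] at this
  rw [hw0, huv, zero_div, zero_smul, add_zero, zero_add] at hv
  nth_rw 1 [hv]
  rw [map_smul, hj.sq, smul_neg, neg_smul]

/-- Up to a multiple of `U`, the shape operator is a multiple of the Hessian: with `e_{2n} = g U`,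
the number `α` equals `g`, so that the term `α J'` cancels the derivative `i` of `i z` in `U`. -/
lemma exists_shapeOperator_fst (hf : ContDiff ℝ 2 f) (hz : graphField f z ≠ 0)
    {e : (E n) → Heis n} {α : ℝ} (he : IsCharacteristicFrameAt (graphMap f) z e α) :
    ∃ g : ℝ, g ≠ 0 ∧ ∀ w, ∃ c : ℝ,
      (shapeOperator (graphMap f) e α z w).1 = -g • graphHessian f z w + c • graphField f z := by
  have hj := isHermitianStructure_mulI (n := n)
  have hU := hasFDerivAt_graphField hf z
  have hUne := hU.continuousAt.eventually_ne hz
  have hR0 : ⟪graphField f z, graphField f z⟫_ℝ ≠ 0 := inner_self_ne_zero.2 hz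
  set G : (E n) → ℝ := fun y =>
    -(⟪mulI n (graphField f y), (e y).1⟫_ℝ / ⟪graphField f y, graphField f y⟫_ℝ) with hG
  have hperp : ∀ᶠ y in 𝓝 z, mulI n (e y).1 = G y • graphField f y := by
    filter_upwards [hUne, he.mem, he.perp] with y hy h1 h2
    refine mulI_eq_smul_of_perp hy ((mem_horizontalTangent_graphMap hf).1 h1).2 fun w h3 h4 => ?_
    exact (levi_eq _ _).symm.trans
      (h2 (w, fderiv ℝ f y w) ((mem_xiPrime_graphMap hf).2 ⟨rfl, h3, h4⟩))
  have hGz := hperp.self_of_nhds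
  have hunit : G z ^ 2 * ⟪graphField f z, graphField f z⟫_ℝ = 1 := by
    have h1 := he.unit.self_of_nhds
    rw [levi_eq, ← hj.inner_map_map, hGz, real_inner_smul_left, real_inner_smul_right] at h1
    rw [← h1]
    ring
  -- The condition on `α` is `α ⟪U, e_{2n}⟫ = 1`, and `e_{2n}` is a unit vector.
  have hα : α = G z := by
    have h1 := (mem_tangentSpace_graphMap hf).1 he.alpha_mem
    have h2 : α * ⟪graphField f z, mulI n (e z).1⟫_ℝ = 1 := by
      rw [inner_graphField]
      simp only [horizontalNormal, J_eq, reeb, Prod.fst_add, Prod.snd_add, Prod.smul_fst,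
        Prod.smul_snd, add_zero, map_smul, smul_eq_mul, graphMap] at h1
      linarith
    rw [hGz, real_inner_smul_right] at h2
    linear_combination G z * h2 - α * hunit
  have he1 : DifferentiableAt ℝ (fun y => (e y).1) z :=
    (he.contDiffAt.differentiableAt one_ne_zero).fst
  have hGd : DifferentiableAt ℝ G z := by
    have hR : DifferentiableAt ℝ (fun y => ⟪graphField f y, graphField f y⟫_ℝ) z :=
      hU.differentiableAt.inner ℝ hU.differentiableAt
    have hN : DifferentiableAt ℝ (fun y => ⟪mulI n (graphField f y), (e y).1⟫_ℝ) z :=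
      ((mulI n).differentiableAt.comp z hU.differentiableAt).inner ℝ he1
    simp only [hG, div_eq_mul_inv]
    exact (hN.fun_mul (hR.fun_inv hR0)).fun_neg
  have hder : fderiv ℝ (fun y => (horizontalNormal (graphMap f) e y).1) z = _ :=
    ((hGd.hasFDerivAt.fun_smul hU).congr_of_eventuallyEq (by
      filter_upwards [hperp] with y hy
      rw [horizontalNormal, J_eq, ← hy])).fderiv
  refine ⟨G z, fun h0 => by rw [h0] at hunit; norm_num at hunit, fun w => ?_⟩
  refine ⟨-(fderiv ℝ G z w) - G z * (⟪w, (e z).1⟫_ℝ * G z), ?_⟩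
  rw [shapeOperator, covDeriv, horizontalVector_eq, hder, JPrime, J_eq, levi_eq,
    fderiv_graphMap hf, hα]
  simp only [Prod.fst_add, Prod.fst_neg, Prod.smul_fst, Prod.fst_sub, reeb, smul_zero, add_zero,
    add_apply, smul_apply, ContinuousLinearMap.smulRight_apply, map_sub, map_smul, hGz]
  module

/-- At an umbilic point, the Hessian restricted to `ξ'` is, modulo `U`, a multiple of the
identity. -/
lemma graphHessian_of_isUmbilicAt (hf : ContDiff ℝ 2 f) (hz : graphField f z ≠ 0)
    (h : IsUmbilicAt (graphMap f) z) :
    ∃ k : ℝ, ∀ w, ⟪graphField f z, w⟫_ℝ = 0 → ⟪mulI n (graphField f z), w⟫_ℝ = 0 →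
      ∃ c : ℝ, graphHessian f z w = k • w + c • graphField f z := by
  obtain ⟨e, α, he, hinv, k, hk⟩ := h
  obtain ⟨g, hg, hS⟩ := exists_shapeOperator_fst hf hz he
  let P : Submodule ℝ (E n) :=
    (Submodule.span ℝ {graphField f z, mulI n (graphField f z)})ᗮ
  have hUP : graphField f z ∈ Pᗮ :=
    Submodule.le_orthogonal_orthogonal _ (Submodule.subset_span (by simp))
  have hP : ∀ w, w ∈ P ↔ ⟪graphField f z, w⟫_ℝ = 0 ∧ ⟪mulI n (graphField f z), w⟫_ℝ = 0 := by
    intro w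
    constructor
    · intro hw
      have hw' := (Submodule.mem_orthogonal _ w).1 hw
      exact ⟨hw' _ (Submodule.subset_span (by simp)), hw' _ (Submodule.subset_span (by simp))⟩
    · rintro ⟨h1, h2⟩
      rw [Submodule.mem_orthogonal]
      intro x hx
      obtain ⟨a, b, rfl⟩ := Submodule.mem_span_pair.1 hx
      rw [inner_add_left, real_inner_smul_left, real_inner_smul_left, h1, h2]
      ring
  have hmem : ∀ w ∈ P, fderiv ℝ (graphMap f) z w ∈ xiPrime (graphMap f) z := by
    intro w hw
    rw [fderiv_graphMap hf, mem_xiPrime_graphMap hf]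
    exact ⟨rfl, (hP w).1 hw⟩
  have hSmem : ∀ w ∈ P, (shapeOperator (graphMap f) e α z w).1 ∈ P := fun w hw =>
    (hP _).2 ((mem_xiPrime_graphMap hf).1 (hinv w (hmem w hw))).2
  -- The compression of the Hessian to `ξ'` is the shape operator.
  let T : P →ₗ[ℝ] P := (P.orthogonalProjectionOnto.toLinearMap ∘ₗ
    (-g • (graphHessian f z).toLinearMap)) ∘ₗ P.subtype
  have hT : ∀ w : P, (T w : E n) = (shapeOperator (graphMap f) e α z w).1 := by
    intro w
    obtain ⟨c, hc⟩ := hS w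
    have h1 : T w = P.orthogonalProjectionOnto (-g • graphHessian f z w) := rfl
    have h2 := P.starProjection_eq_self_iff.2 (hSmem w w.2)
    rw [h1, ← h2, hc, map_add, map_smul _ c,
      (Submodule.starProjection_apply_eq_zero_iff P).2 hUP, smul_zero, add_zero]
    rfl
  have hTsymm : T.IsSymmetric := by
    intro v w
    rw [Submodule.coe_inner, Submodule.coe_inner, hT, hT]
    obtain ⟨c, hc⟩ := hS v
    obtain ⟨d, hd⟩ := hS w
    rw [hc, hd, inner_add_left, inner_add_right, real_inner_smul_left, real_inner_smul_left,
      real_inner_smul_right, real_inner_smul_right, ((hP _).1 w.2).1,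
      real_inner_comm (graphField f z) (v : E n), ((hP _).1 v.2).1, graphHessian_symm hf]
    ring
  have hTk := eq_smul_of_unique_eigenvalue hTsymm (k := k) fun μ w hw hμ => by
    refine hk μ w (by simpa using hw) (hmem w w.2) ?_
    have h1 : (shapeOperator (graphMap f) e α z w).1 = μ • (w : E n) := by
      rw [← hT, hμ]
      rfl
    have h2 := ((mem_xiPrime_graphMap hf).1 (hinv w (hmem w w.2))).1
    rw [fderiv_graphMap hf]
    refine Prod.ext h1 ?_
    rw [h2, h1, map_smul]
    rfl
  refine ⟨-(k / g), fun w h1 h2 => ?_⟩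
  obtain ⟨c, hc⟩ := hS w
  have h3 : (shapeOperator (graphMap f) e α z w).1 = k • w := by
    rw [← hT ⟨w, (hP w).2 ⟨h1, h2⟩⟩, hTk]
    rfl
  refine ⟨c / g, ?_⟩
  have h4 : g • graphHessian f z w = c • graphField f z - k • w := by
    rw [← h3, hc]
    module
  rw [← inv_smul_smul₀ hg (graphHessian f z w), h4]
  module

/-- Where the `p`-mean curvature vanishes, so does the trace of the Hessian on the orthogonal
complement of `U`. -/
lemma sum_graphHessian_of_pMinimal (hf : ContDiff ℝ 2 f) (hz : graphField f z ≠ 0)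
    (h : HasPMeanCurvatureAt (graphMap f) z 0) :
    ∃ b : Fin (2 * n - 1) → E n, Orthonormal ℝ b ∧ (∀ i, ⟪graphField f z, b i⟫_ℝ = 0) ∧
      ∑ i, ⟪graphHessian f z (b i), b i⟫_ℝ = 0 := by
  obtain ⟨e, α, he, b, hb1, hb2, hb3⟩ := h
  obtain ⟨g, hg, hS⟩ := exists_shapeOperator_fst hf hz he
  have hUb : ∀ i, ⟪graphField f z, b i⟫_ℝ = 0 := by
    intro i
    have := mem_contactSpace.1 (hb1 i)
    rw [fderiv_graphMap hf] at this
    rw [inner_graphField]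
    exact this
  refine ⟨b, orthonormal_iff_ite.2 fun i j => ?_, hUb, ?_⟩
  · rw [← hb2 i j, levi_eq, fderiv_graphMap hf, fderiv_graphMap hf]
  · have h1 : ∀ i, levi (shapeOperator (graphMap f) e α z (b i)) (fderiv ℝ (graphMap f) z (b i)) =
        -g * ⟪graphHessian f z (b i), b i⟫_ℝ := by
      intro i
      obtain ⟨c, hc⟩ := hS (b i)
      rw [levi_eq, fderiv_graphMap hf, hc, inner_add_left, real_inner_smul_left,
        real_inner_smul_left, hUb, mul_zero, add_zero]
    simp only [h1, ← Finset.mul_sum] at hb3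
    exact (mul_eq_zero.1 hb3.symm).resolve_left (neg_ne_zero.2 hg)

/-- Parseval's identity in a hyperplane. -/
lemma sum_inner_sq_of_orthonormal (hn : 2 ≤ n) {u x : E n} (hu : u ≠ 0)
    {b : Fin (2 * n - 1) → E n} (hb : Orthonormal ℝ b) (hub : ∀ i, ⟪u, b i⟫_ℝ = 0)
    (hux : ⟪u, x⟫_ℝ = 0) : ∑ i, ⟪x, b i⟫_ℝ ^ 2 = ⟪x, x⟫_ℝ := by
  have : Fact (Module.finrank ℝ (E n) = (2 * n - 1) + 1) :=
    ⟨by rw [finrank_euclideanSpace_complex]; omega⟩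
  have : Nonempty (Fin (2 * n - 1)) := ⟨⟨0, by omega⟩⟩
  let P : Submodule ℝ (E n) := (Submodule.span ℝ {u})ᗮ
  have hbP : ∀ i, b i ∈ P := fun i => Submodule.mem_orthogonal_singleton_iff_inner_right.2 (hub i)
  have hon : Orthonormal ℝ (fun i => (⟨b i, hbP i⟩ : P)) :=
    ⟨fun i => hb.1 i, fun i j hij => hb.2 hij⟩
  have hcard : Fintype.card (Fin (2 * n - 1)) = Module.finrank ℝ P := by
    rw [Fintype.card_fin, Submodule.finrank_orthogonal_span_singleton (n := 2 * n - 1) hu]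
  let B := basisOfOrthonormalOfCardEqFinrank hon hcard
  have hB : ⇑B = fun i => (⟨b i, hbP i⟩ : P) := coe_basisOfOrthonormalOfCardEqFinrank hon hcard
  have h1 := (B.toOrthonormalBasis (by rw [hB]; exact hon)).sum_sq_inner_left
    ⟨x, Submodule.mem_orthogonal_singleton_iff_inner_right.2 hux⟩
  simp only [Module.Basis.coe_toOrthonormalBasis, hB] at h1
  rw [← real_inner_self_eq_norm_sq] at h1
  exact h1

/-- For a `p`-minimal umbilic graph, the trace condition identifies the eigenvalue of the Hessian on
`ξ'` with `scal`. -/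
lemma isUmbilicMinimalField_graph (hn : 2 ≤ n) (hf : ContDiff ℝ 2 f)
    (hfreg : ∀ z, IsRegularPoint (graphMap f) z → ContDiffAt ℝ ∞ f z)
    (hmin : IsPMinimal (graphMap f)) (humb : IsUmbilic (graphMap f)) :
    IsUmbilicMinimalField (mulI n) (graphField f) (graphHessian f) ((2 * n - 1 : ℕ) : ℝ) where
  hermitian := isHermitianStructure_mulI
  ne_one := by
    intro h
    have : 2 * n - 1 = 1 := by exact_mod_cast h
    omega
  exists_unit := exists_unit_perp hn
  hasFDerivAt := hasFDerivAt_graphField hf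
  continuous := continuous_graphHessian hf
  symm _ := graphHessian_symm hf
  differentiableAt z hz :=
    differentiableAt_graphHessian (hfreg z (isRegularPoint_graphMap hf hz))
  umbilic z hz := by
    have hj := isHermitianStructure_mulI (n := n)
    have hreg := isRegularPoint_graphMap hf hz
    obtain ⟨k, hk⟩ := graphHessian_of_isUmbilicAt hf hz (humb z hreg)
    obtain ⟨b, hb, hUb, hsum⟩ := sum_graphHessian_of_pMinimal hf hz (hmin z hreg)
    have hsq := sum_inner_sq_of_orthonormal hn hz hb hUb (hj.inner_self_right (graphField f z))
    -- In an orthonormal basis of the complement of `U`, the vanishing trace of the Hessian is the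
    -- sum of `k`, taken `2n - 2` times, and of its value on the unit vector `iU / |U|`.
    suffices hscal : scal (mulI n) (graphField f) (graphHessian f) ((2 * n - 1 : ℕ) : ℝ) z = k by
      rw [hscal]
      exact hk
    have hsymm := graphHessian_symm hf (z := z)
    have hm : (1 : ℝ) - ((2 * n - 1 : ℕ) : ℝ) ≠ 0 := by
      have : 2 * n - 1 ≠ 1 := by omega
      have : ((2 * n - 1 : ℕ) : ℝ) ≠ 1 := by exact_mod_cast this
      exact sub_ne_zero.2 this.symm
    rw [scal]
    rw [hj.inner_map_map] at hsq
    have hR0 : ⟪graphField f z, graphField f z⟫_ℝ ≠ 0 := inner_self_ne_zero.2 hz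
    generalize graphHessian f z = T at *
    generalize graphField f z = u at *
    have hterm : ∀ i, ⟪T (b i), b i⟫_ℝ = k + ⟪mulI n u, b i⟫_ℝ ^ 2 *
        ((⟪T (mulI n u), mulI n u⟫_ℝ / ⟪u, u⟫_ℝ - k) / ⟪u, u⟫_ℝ) := by
      intro i
      obtain ⟨w, huw, hjuw, hw⟩ := exists_decomposition hj hz (b i)
      obtain ⟨c, hc⟩ := hk w huw hjuw
      rw [hUb, zero_div, zero_smul, add_zero] at hw
      obtain ⟨y, hy⟩ : ∃ y, y = ⟪mulI n u, b i⟫_ℝ / ⟪u, u⟫_ℝ := ⟨_, rfl⟩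
      have hy' : ⟪mulI n u, b i⟫_ℝ = y * ⟪u, u⟫_ℝ := by rw [hy]; field_simp
      rw [← hy] at hw
      have hTw : ⟪T w, mulI n u⟫_ℝ = 0 := by
        rw [hc, inner_add_left, real_inner_smul_left, real_inner_smul_left, hj.inner_self_right,
          real_inner_comm, hjuw]
        ring
      have hTw' : ⟪T (mulI n u), w⟫_ℝ = 0 := by rw [hsymm, real_inner_comm, hTw]
      have hTww : ⟪T w, w⟫_ℝ = k * ⟪w, w⟫_ℝ := by
        rw [hc, inner_add_left, real_inner_smul_left, real_inner_smul_left, huw]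
        ring
      have hnorm : ⟪w, w⟫_ℝ = 1 - y ^ 2 * ⟪u, u⟫_ℝ := by
        have h1 : ⟪b i, b i⟫_ℝ = 1 := by rw [real_inner_self_eq_norm_sq, hb.1 i]; norm_num
        rw [hw] at h1
        simp only [inner_add_left, inner_add_right, real_inner_smul_left, real_inner_smul_right,
          hj.inner_map_map, hjuw, real_inner_comm (mulI n u) w] at h1
        linarith
      rw [hy', hw]
      simp only [map_add, map_smul, inner_add_left, inner_add_right, real_inner_smul_left,
        real_inner_smul_right, hTw, hTw', hTww, hnorm]
      field_simp
      ring
    simp only [hterm, Finset.sum_add_distrib, ← Finset.sum_mul, hsq, Finset.sum_const,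
      Finset.card_univ, Fintype.card_fin, nsmul_eq_mul] at hsum
    field_simp at hsum ⊢
    linarith

/-- The graph of an affine function is moved to a horizontal hyperplane by a left translation. -/
lemma exists_rigidMotion_of_affine (g : E n) (c : ℝ) (hf : ∀ z, f z = ⟪g, z⟫_ℝ + c) :
    ∃ Φ : Heis n ≃ Heis n, IsRigidMotion Φ ∧
      IsHorizontalHyperplane (Φ '' Set.range (graphMap f)) := by
  have hj := isHermitianStructure_mulI (n := n)
  let Φ : Heis n ≃ Heis n :=
    { toFun := fun p => (p.1 - mulI n g, p.2 - ⟪g, p.1⟫_ℝ)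
      invFun := fun p => (p.1 + mulI n g, p.2 + ⟪g, p.1⟫_ℝ)
      left_inv := fun p => by
        refine Prod.ext (by simp) ?_
        simp only [inner_sub_right, hj.inner_self_right]
        ring
      right_inv := fun p => by
        refine Prod.ext (by simp) ?_
        simp only [inner_add_right, hj.inner_self_right]
        ring }
  have hderiv : ∀ p v, fderiv ℝ Φ p v = (v.1, v.2 - ⟪g, v.1⟫_ℝ) := by
    intro p v
    have h1 : HasFDerivAt (fun p : Heis n => p.1 - mulI n g) (ContinuousLinearMap.fst ℝ _ _) p :=
      hasFDerivAt_fst.sub_const _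
    have h2 : HasFDerivAt (fun p : Heis n => p.2 - ⟪g, p.1⟫_ℝ)
        (ContinuousLinearMap.snd ℝ _ _ - (innerSL ℝ g).comp (ContinuousLinearMap.fst ℝ _ _)) p :=
      hasFDerivAt_snd.fun_sub ((innerSL ℝ g).hasFDerivAt.comp p hasFDerivAt_fst)
    have h3 : HasFDerivAt Φ _ p := h1.prodMk h2
    rw [h3.fderiv]
    rfl
  refine ⟨Φ, ⟨?_, ?_, ?_, ?_⟩, c, ?_⟩
  · exact (contDiff_fst.sub contDiff_const).prodMk
      (contDiff_snd.sub (contDiff_const.inner ℝ contDiff_fst))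
  · exact (contDiff_fst.add contDiff_const).prodMk
      (contDiff_snd.add (contDiff_const.inner ℝ contDiff_fst))
  · intro p v
    rw [hderiv, contactForm_eq, contactForm_eq]
    have : (Φ p).1 = p.1 - mulI n g := rfl
    rw [this, map_sub, hj.sq, inner_sub_left, inner_neg_left]
    ring
  · intro p v _
    rw [hderiv, hderiv, J_eq, J_eq]
    have : (Φ p).1 = p.1 - mulI n g := rfl
    rw [this, map_sub, hj.sq, inner_sub_left, inner_neg_left]
    refine Prod.ext rfl ?_
    simp only
    ring
  · ext p
    constructor
    · rintro ⟨_, ⟨z, rfl⟩, rfl⟩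
      change f z - ⟪g, z⟫_ℝ = c
      rw [hf]
      ring
    · intro hp
      refine ⟨graphMap f (p.1 + mulI n g), ⟨_, rfl⟩, Prod.ext ?_ ?_⟩
      · exact add_sub_cancel_right _ _
      · change f (p.1 + mulI n g) - ⟪g, p.1 + mulI n g⟫_ℝ = p.2
        rw [hf, show p.2 = c from hp]
        ring

/-- A function with vanishing Hessian is affine. -/
lemma exists_affine_of_graphHessian_eq_zero (hf : ContDiff ℝ 2 f)
    (h : ∀ z, graphHessian f z = 0) : ∃ (g : E n) (c : ℝ), ∀ z, f z = ⟪g, z⟫_ℝ + c := by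
  have h0 : ∀ z, fderiv ℝ (fderiv ℝ f) z = 0 := by
    intro z
    ext v w
    rw [← inner_riesz]
    have h1 : riesz n (fderiv ℝ (fderiv ℝ f) z v) = 0 := congrArg (fun T => T v) (h z)
    rw [h1, inner_zero_left]
    rfl
  have hd : Differentiable ℝ (fderiv ℝ f) :=
    (hf.fderiv_right (m := 1) le_rfl).differentiable one_ne_zero
  have hconst := is_const_of_fderiv_eq_zero hd h0
  have hlin : ∀ z, HasFDerivAt (fun z => f z - fderiv ℝ f 0 z) (0 : (E n) →L[ℝ] ℝ) z := by
    intro z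
    have h1 := ((hf.differentiable two_ne_zero) z).hasFDerivAt.fun_sub
      (fderiv ℝ f 0).hasFDerivAt
    rwa [hconst z 0, sub_self] at h1
  refine ⟨riesz n (fderiv ℝ f 0), f 0, fun z => ?_⟩
  have h2 := is_const_of_fderiv_eq_zero (fun z => (hlin z).differentiableAt)
    (fun z => (hlin z).fderiv) z 0
  rw [map_zero, sub_zero] at h2
  rw [inner_riesz, ← h2]
  ring

end shape

end Heisenberg

end

theorem mainTheorem5 (n : ℕ) (hn : 2 ≤ n) (f : EuclideanSpace ℂ (Fin n) → ℝ)
    (hf : ContDiff ℝ 2 f)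
    (hfreg : ∀ z, Heisenberg.IsRegularPoint (Heisenberg.graphMap f) z → ContDiffAt ℝ ∞ f z)
    (hmin : Heisenberg.IsPMinimal (Heisenberg.graphMap f))
    (humb : Heisenberg.IsUmbilic (Heisenberg.graphMap f)) :
    ∃ Φ : Heisenberg.Heis n ≃ Heisenberg.Heis n, Heisenberg.IsRigidMotion Φ ∧
      Heisenberg.IsHorizontalHyperplane (Φ '' Set.range (Heisenberg.graphMap f)) := by
  have h := Heisenberg.isUmbilicMinimalField_graph hn hf hfreg hmin humb
  obtain ⟨g, c, hgc⟩ := Heisenberg.exists_affine_of_graphHessian_eq_zero hf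
    (h.eq_zero (by omega))
  exact Heisenberg.exists_rigidMotion_of_affine g c hgc
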